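/- Let $U\subset\mathbb{Z}^3$ be the finite set of primitive generators of the rays of a strongly convex rational polyhedral cone $\mathcal{C}\subset\mathbb{R}^3$ of dimension 3, so that the cone generated by any proper subset of $U$ is strictly smaller than $\mathcal{C}$. Let $\Delta$ be the fan consisting of $\mathcal{C}$ and its faces. Suppose that the affine toric variety $X_\Delta$ is Gorenstein, i.e. there is an integral linear form $\gamma\in(\mathbb{Z}^3)^*$ with $\gamma(u)=-1$ for all $u\in U$. Put $H_\gamma=\{x\in\mathbb{R}^3:\gamma(x)=-1\}$, and let $P_\Delta=\mathcal{C}\cap H_\gamma$, a lattice polygon. Suppose that the relative interior of $P_\Delta$ contains a point of $\mathbb{Z}^3$. Then there is a basic lattice triangulation $\mathcal{T}$ of $P_\Delta$ (all vertices lie in $\mathbb{Z}^3$, and the vertices of every triangle form a basis of the affine lattice $H_\gamma\cap\mathbb{Z}^3$) such that the cones over the simplices of $\mathcal{T}$, together with $\{0\}$, form a fan $\tilde\Delta$ subdividing $\Delta$ which admits a compact strictly upper convex support function. That is, there is $h:\mathcal{C}\to\mathbb{R}$ such that: 1. $h$ is linear on each cone of $\tilde\Delta$; 2. $h(x+y)\ge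 h(x)+h(y)$ for all $x,y\in\mathcal{C}$; 3. for every 3-dimensional cone $\sigma\in\tilde\Delta$, the linear form $l_\sigma$ with $h=l_\sigma$ on $\sigma$ satisfies $h(x)\le l_\sigma(x)$ for all $x\in\mathcal{C}$, with equality only for $x\in\sigma$; 4. $h(u)=0$ for all $u\in U$. -/

import Mathlib

namespace ToricCone

/-- The integral points of `ℝⁿ`: the lattice `ℤⁿ ⊂ ℝⁿ`. -/
def IsLatticePoint {n : ℕ} (x : Fin n → ℝ) : Prop :=
  ∃ z : Fin n → ℤ, ∀ i, x i = (z i : ℝ)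

/-- A lattice vector is primitive if it is not `p • v` with `v` a lattice vector and `p > 1`
(in particular it is nonzero). -/
def IsPrimitive {n : ℕ} (u : Fin n → ℝ) : Prop :=
  IsLatticePoint u ∧ ∀ (p : ℕ) (v : Fin n → ℝ), IsLatticePoint v → u = (p : ℝ) • v → ¬ 1 < p

/-- The pairing of an element `γ` of the dual lattice with a vector. -/
def pairing {n : ℕ} (γ : Fin n → ℤ) (x : Fin n → ℝ) : ℝ :=
  ∑ i, (γ i : ℝ) * x i

/-- The cone is strongly convex: `σ ∩ (-σ) = {0}`. -/
def IsStronglyConvex {n : ℕ} (σ : PointedCone ℝ (Fin n → ℝ)) : Prop :=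
  ∀ x, x ∈ σ → -x ∈ σ → x = 0

/-- Strongly convex rational polyhedral cones: generated by finitely many lattice vectors, and
containing no line. -/
def IsRationalCone {n : ℕ} (σ : PointedCone ℝ (Fin n → ℝ)) : Prop :=
  (∃ S : Finset (Fin n → ℝ), (∀ u ∈ S, IsLatticePoint u) ∧
    σ = PointedCone.hull ℝ (S : Set (Fin n → ℝ))) ∧ IsStronglyConvex σ

/-- A fan in `ℤⁿ`: a nonempty collection of strongly convex rational polyhedral cones, closed under
passing to faces, any two of which meet in a common face. -/
structure IsFan {n : ℕ} (Δ : Set (PointedCone ℝ (Fin n → ℝ))) : Prop where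
  nonempty : Δ.Nonempty
  rational : ∀ σ ∈ Δ, IsRationalCone σ
  face_mem : ∀ σ ∈ Δ, ∀ τ : PointedCone ℝ (Fin n → ℝ), τ.IsFaceOf σ → τ ∈ Δ
  inter_face : ∀ σ ∈ Δ, ∀ τ ∈ Δ, (σ ⊓ τ).IsFaceOf σ ∧ (σ ⊓ τ).IsFaceOf τ

/-- The support `|Δ|`, the union of the cones of `Δ`. -/
def support {n : ℕ} (Δ : Set (PointedCone ℝ (Fin n → ℝ))) : Set (Fin n → ℝ) :=
  {x | ∃ σ ∈ Δ, x ∈ σ}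

/-- The fan `Δ'` is a subdivision of `Δ`: it has the same support, and each of its cones lies in a
cone of `Δ`. -/
def IsSubdivision {n : ℕ} (Δ' Δ : Set (PointedCone ℝ (Fin n → ℝ))) : Prop :=
  IsFan Δ' ∧ (∀ σ' ∈ Δ', ∃ σ ∈ Δ, σ' ≤ σ) ∧ support Δ' = support Δ

/-- The dimension of a cone is that of its linear span. -/
noncomputable def coneDim {n : ℕ} (σ : PointedCone ℝ (Fin n → ℝ)) : ℕ :=
  Module.finrank ℝ (Submodule.span ℝ (σ : Set (Fin n → ℝ)))

/-- `h` is a support function on `Δ`: linear on each cone. Only the values on `|Δ|` matter. -/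
def IsSupportFunction {n : ℕ} (Δ : Set (PointedCone ℝ (Fin n → ℝ))) (h : (Fin n → ℝ) → ℝ) : Prop :=
  ∀ σ ∈ Δ, ∃ l : Module.Dual ℝ (Fin n → ℝ), ∀ x ∈ σ, h x = l x

/-- `h` is (upper) convex: `h (x + y) ≥ h x + h y` on `|Δ|`. -/
def IsUpperConvex {n : ℕ} (Δ : Set (PointedCone ℝ (Fin n → ℝ))) (h : (Fin n → ℝ) → ℝ) : Prop :=
  ∀ x ∈ support Δ, ∀ y ∈ support Δ, h x + h y ≤ h (x + y)

/-- `h` is strictly (upper) convex: convex, and for each `n`-dimensional cone `σ` of the fan, the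
linear form `l` giving `h` on `σ` satisfies `h ≤ l` on `|Δ|` with equality only on `σ`. -/
def IsStrictlyUpperConvex {n : ℕ} (Δ : Set (PointedCone ℝ (Fin n → ℝ)))
    (h : (Fin n → ℝ) → ℝ) : Prop :=
  IsUpperConvex Δ h ∧
    ∀ σ ∈ Δ, coneDim σ = n → ∀ l : Module.Dual ℝ (Fin n → ℝ), (∀ x ∈ σ, h x = l x) →
      ∀ x ∈ support Δ, h x ≤ l x ∧ (h x = l x → x ∈ σ)

/-- `U` is the set of spanning vectors of an `n`-dimensional Gorenstein toric cone, with `γ` the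
element of the dual lattice exhibiting the Gorenstein condition: the cone generated by `U` is
strongly convex and `n`-dimensional, the elements of `U` are primitive lattice vectors, none of them
can be removed without changing the cone, and `γ` takes the value `-1` on each of them. -/
structure IsGorensteinToricCone {n : ℕ} (U : Finset (Fin n → ℝ)) (γ : Fin n → ℤ) : Prop where
  primitive : ∀ u ∈ U, IsPrimitive u
  minimal : ∀ u ∈ U, PointedCone.hull ℝ ((U : Set (Fin n → ℝ)) \ {u}) ≠
    PointedCone.hull ℝ (U : Set (Fin n → ℝ))
  stronglyConvex : IsStronglyConvex (PointedCone.hull ℝ (U : Set (Fin n → ℝ)))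
  fullDim : coneDim (PointedCone.hull ℝ (U : Set (Fin n → ℝ))) = n
  gorenstein : ∀ u ∈ U, pairing γ u = -1

/-- The fan `Δ` of the affine toric variety: the cone generated by `U` and all its faces. -/
def coneFan {n : ℕ} (U : Finset (Fin n → ℝ)) : Set (PointedCone ℝ (Fin n → ℝ)) :=
  {σ | σ.IsFaceOf (PointedCone.hull ℝ (U : Set (Fin n → ℝ)))}

/-- The polytope `P_Δ`, the slice of the cone by the hyperplane `H_γ = {γ = -1}`. -/
def polytope {n : ℕ} (U : Finset (Fin n → ℝ)) (γ : Fin n → ℤ) : Set (Fin n → ℝ) :=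
  {x | x ∈ PointedCone.hull ℝ (U : Set (Fin n → ℝ)) ∧ pairing γ x = -1}

/-- `K` is a basic lattice triangulation of `P_Δ`: a triangulation of `P_Δ` all of whose vertices
are lattice points, such that the vertices of each top-dimensional simplex (`n` of them, as `P_Δ`
has dimension `n - 1`) form a basis of the affine lattice `H_γ ∩ ℤⁿ`; being affinely independent,
they do so as soon as they generate it by integral affine combinations. -/
structure IsBasicLatticeTriangulation {n : ℕ} (K : Geometry.SimplicialComplex ℝ (Fin n → ℝ))
    (U : Finset (Fin n → ℝ)) (γ : Fin n → ℤ) : Prop where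
  space_eq : K.space = polytope U γ
  lattice : ∀ s ∈ K.faces, ∀ v ∈ s, IsLatticePoint v
  basic : ∀ s ∈ K.faces, s.card = n → ∀ x : Fin n → ℝ, IsLatticePoint x → pairing γ x = -1 →
    ∃ c : (Fin n → ℝ) → ℤ, ∑ v ∈ s, c v = 1 ∧ ∑ v ∈ s, (c v : ℝ) • v = x

/-- The cones over the simplices of a triangulation, together with the zero cone. -/
def fanOver {n : ℕ} (K : Geometry.SimplicialComplex ℝ (Fin n → ℝ)) :
    Set (PointedCone ℝ (Fin n → ℝ)) :=
  {σ | σ = ⊥ ∨ ∃ s ∈ K.faces, σ = PointedCone.hull ℝ (s : Set (Fin n → ℝ))}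

/-- A strictly upper convex support function is compact if it vanishes on the spanning vectors of
the original cone. -/
def IsCompactStrictlyUpperConvexSupportFunction {n : ℕ} (U : Finset (Fin n → ℝ))
    (Δ : Set (PointedCone ℝ (Fin n → ℝ))) (h : (Fin n → ℝ) → ℝ) : Prop :=
  IsSupportFunction Δ h ∧ IsStrictlyUpperConvex Δ h ∧ ∀ u ∈ U, h u = 0

end ToricCone

/-! Let `A` be the set of lattice points of P_Δ. Heights `w` on `A` induce a regular triangulation:
its maximal simplices are the bases `σ ⊆ A` whose form `interp σ w` lies above `w` on `A`
(`simplices`), and `h` is the minimum of these forms. Superadditivity is then automatic, and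
everything else depends on choosing `w` well.

Three properties suffice. The heights vanish on `U`. They are generic, so that no further point of
`A` lifts onto the plane over a maximal simplex. And a point of `A` lying in a simplex without being
a vertex of it is strictly above the interpolating form. The third property leaves each maximal
triangle with no lattice points but its vertices, and such a triangle is basic (`exists_int_coord`).
An element of `U` is an extreme point, hence a vertex of every simplex containing it, so `h` takes
the value of `w` there, namely 0.

`exists_isGenericHeight` builds `w` at three scales: the constant 1 off `U`, minus a small multiple
of a strictly convex function off `U`, plus a still smaller generic function vanishing on `U`. The
heights on `U` cannot be perturbed, so genericity must fail for simplices with all vertices in `U`.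
The interior lattice point rules these out: it has positive height, while the form of such a simplex
is zero.

The simplices cover the cone (`exists_mem_simplices`) by a linear programming argument: a basis
maximising the interpolated value at a generic point must lie above `w`, for otherwise the pivot
`exists_isBasisSet_exchange` improves it. They meet in common faces (`hull_inf_hull`) because two
forms that agree at a common point force its coordinates onto the shared vertices. The same
comparison gives strict convexity. -/

namespace ToricCone

open Filter Topology

/-! ### Coordinates and interpolation on a basis; cones and their affine slices -/

section BasisSet

variable {E : Type*} [AddCommGroup E] [Module ℝ E]

/-- A finite set of vectors that is a basis of the space. -/
structure IsBasisSet (σ : Finset E) : Prop where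
  linearIndependent : LinearIndependent ℝ ((↑) : σ → E)
  span_eq_top : Submodule.span ℝ (σ : Set E) = ⊤

/-- The basis of the space formed by the elements of a basis set. -/
noncomputable def IsBasisSet.basis {σ : Finset E} (hσ : IsBasisSet σ) : Module.Basis σ ℝ E :=
  Module.Basis.mk hσ.linearIndependent (by simp [hσ.span_eq_top])

lemma IsBasisSet.basis_apply {σ : Finset E} (hσ : IsBasisSet σ) (v : σ) : hσ.basis v = v := by
  simp [IsBasisSet.basis]

open Classical in
/-- The coordinate of `v` with respect to the basis set `σ` (zero if `v ∉ σ`). -/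
noncomputable def coord (σ : Finset E) (v : E) : E →ₗ[ℝ] ℝ :=
  -- The default 0 lets `coord_nonneg_of_mem_hull` and `coord_eq_zero_of_mem_hull` hold without
  -- assuming `v ∈ σ`.
  if h : IsBasisSet σ ∧ v ∈ σ then h.1.basis.coord ⟨v, h.2⟩ else 0

/-- The linear form taking the values of `w` on the basis set `σ`. -/
noncomputable def interp (σ : Finset E) (w : E → ℝ) : E →ₗ[ℝ] ℝ :=
  ∑ v ∈ σ, w v • coord σ v

variable {σ : Finset E}

lemma interp_apply (σ : Finset E) (w : E → ℝ) (x : E) :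
    interp σ w x = ∑ v ∈ σ, coord σ v x * w v := by
  simp [interp, LinearMap.sum_apply, mul_comm]

lemma sum_coord_smul (hσ : IsBasisSet σ) (x : E) : ∑ v ∈ σ, coord σ v x • v = x := by
  conv_rhs => rw [← hσ.basis.sum_repr x]
  rw [← Finset.sum_coe_sort σ]
  refine Finset.sum_congr rfl fun v _ => ?_
  simp [coord, hσ, IsBasisSet.basis_apply]

lemma coord_sum_smul (hσ : IsBasisSet σ) (c : E → ℝ) {v : E} (hv : v ∈ σ) :
    coord σ v (∑ u ∈ σ, c u • u) = c v := by
  have : ∑ u ∈ σ, c u • u = ∑ u : σ, c u • hσ.basis u := by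
    rw [← Finset.sum_coe_sort σ]
    simp [IsBasisSet.basis_apply]
  rw [this]
  simp only [coord, hσ, hv, and_self, dite_true]
  rw [Module.Basis.coord_apply, Module.Basis.repr_sum_self]

lemma coord_of_notMem {v : E} (hv : v ∉ σ) : coord σ v = 0 := by
  simp [coord, hv]

open Classical in
lemma coord_self (hσ : IsBasisSet σ) {v u : E} (hv : v ∈ σ) (hu : u ∈ σ) :
    coord σ v u = if v = u then 1 else 0 := by
  have := coord_sum_smul hσ (fun y => if y = u then 1 else 0) hv
  simpa [hu] using this

lemma interp_self (hσ : IsBasisSet σ) (w : E → ℝ) {v : E} (hv : v ∈ σ) :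
    interp σ w v = w v := by
  classical
  rw [interp_apply, Finset.sum_congr rfl fun u hu => by rw [coord_self hσ hu hv]]
  simp [hv]

lemma IsBasisSet.ext_dual (hσ : IsBasisSet σ) {f g : E →ₗ[ℝ] ℝ} (h : ∀ v ∈ σ, f v = g v) :
    f = g := by
  ext x
  rw [← sum_coord_smul hσ x, map_sum, map_sum]
  exact Finset.sum_congr rfl fun v hv => by rw [map_smul, map_smul, h v hv]

lemma mem_hull_finset {s : Finset E} {x : E} :
    x ∈ PointedCone.hull ℝ (s : Set E) ↔
      ∃ c : E → ℝ, (∀ v, 0 ≤ c v) ∧ ∑ v ∈ s, c v • v = x := by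
  rw [PointedCone.hull, Submodule.mem_span_finset']
  constructor
  · rintro ⟨f, rfl⟩
    classical
    refine ⟨fun v => if h : v ∈ s then (f ⟨v, h⟩ : ℝ) else 0, fun v => ?_, ?_⟩
    · dsimp only
      split_ifs with h
      · exact (f ⟨v, h⟩).2
      · exact le_rfl
    · rw [← Finset.sum_coe_sort s]
      refine Finset.sum_congr rfl fun v _ => ?_
      simp only [v.2, dite_true]
      rfl
  · rintro ⟨c, hc, rfl⟩
    refine ⟨fun v => ⟨c v, hc v⟩, ?_⟩
    rw [← Finset.sum_coe_sort s]
    rfl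

lemma coord_nonneg_of_mem_hull (hσ : IsBasisSet σ) {x : E}
    (hx : x ∈ PointedCone.hull ℝ (σ : Set E)) (v : E) : 0 ≤ coord σ v x := by
  by_cases hv : v ∈ σ
  · obtain ⟨c, hc, rfl⟩ := mem_hull_finset.1 hx
    rw [coord_sum_smul hσ c hv]
    exact hc v
  · simp [coord_of_notMem hv]

lemma mem_hull_of_coord (hσ : IsBasisSet σ) {s : Finset E} (hs : s ⊆ σ) {x : E}
    (h0 : ∀ v ∈ s, 0 ≤ coord σ v x) (h1 : ∀ v ∈ σ, v ∉ s → coord σ v x = 0) :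
    x ∈ PointedCone.hull ℝ (s : Set E) := by
  have : ∑ v ∈ s, coord σ v x • v = x := by
    conv_rhs => rw [← sum_coord_smul hσ x]
    exact Finset.sum_subset hs fun v hv hvs => by rw [h1 v hv hvs, zero_smul]
  rw [← this]
  exact Submodule.sum_mem _ fun v hv =>
    PointedCone.smul_mem _ (h0 v hv) (PointedCone.subset_hull hv)

lemma mem_hull_iff_coord_nonneg (hσ : IsBasisSet σ) {x : E} :
    x ∈ PointedCone.hull ℝ (σ : Set E) ↔ ∀ v ∈ σ, 0 ≤ coord σ v x :=
  ⟨fun h v _ => coord_nonneg_of_mem_hull hσ h v,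
    fun h => mem_hull_of_coord hσ subset_rfl h fun _ h h' => absurd h h'⟩

lemma coord_eq_zero_of_mem_hull (hσ : IsBasisSet σ) {s : Finset E} (hs : s ⊆ σ) {x : E}
    (hx : x ∈ PointedCone.hull ℝ (s : Set E)) {v : E} (hv : v ∉ s) : coord σ v x = 0 := by
  classical
  by_cases hvσ : v ∈ σ
  · obtain ⟨c, -, rfl⟩ := mem_hull_finset.1 hx
    rw [map_sum]
    refine Finset.sum_eq_zero fun u hu => ?_
    rw [map_smul, coord_self hσ hvσ (hs hu), if_neg (by rintro rfl; exact hv hu), smul_zero]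
  · simp [coord_of_notMem hvσ]

lemma IsBasisSet.of_card [FiniteDimensional ℝ E] (hc : σ.card = Module.finrank ℝ E)
    (hs : Submodule.span ℝ (σ : Set E) = ⊤) : IsBasisSet σ :=
  ⟨linearIndependent_of_top_le_span_of_card_eq_finrank (by simp [hs]) (by simpa using hc), hs⟩

lemma IsBasisSet.card_eq (hσ : IsBasisSet σ) : σ.card = Module.finrank ℝ E := by
  rw [Module.finrank_eq_card_basis hσ.basis, Fintype.card_coe]

lemma IsBasisSet.span_ne_top (hσ : IsBasisSet σ) {v : E} (hv : v ∈ σ) {s : Finset E} (hs : s ⊆ σ)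
    (hvs : v ∉ s) : Submodule.span ℝ (s : Set E) ≠ ⊤ := by
  classical
  intro h
  have h1 : Submodule.span ℝ (s : Set E) ≤ LinearMap.ker (coord σ v) := by
    rw [Submodule.span_le]
    intro u hu
    simp only [SetLike.mem_coe, LinearMap.mem_ker]
    rw [coord_self hσ hv (hs hu), if_neg (by rintro rfl; exact hvs hu)]
  have h2 := h1 (h ▸ Submodule.mem_top : v ∈ Submodule.span ℝ (s : Set E))
  rw [LinearMap.mem_ker, coord_self hσ hv hv] at h2
  simp at h2

section Slice

variable {φ : E →ₗ[ℝ] ℝ} {s : Finset E}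

lemma map_eq_of_mem_convexHull (hφ : ∀ v ∈ s, φ v = -1) {x : E}
    (hx : x ∈ convexHull ℝ (s : Set E)) : φ x = -1 := by
  have : convexHull ℝ (s : Set E) ⊆ {x | φ x = -1} :=
    convexHull_min (fun v hv => hφ v hv) (convex_hyperplane φ.isLinear _)
  exact this hx

lemma convexHull_subset_hull (s : Set E) :
    convexHull ℝ s ⊆ (PointedCone.hull ℝ s : Set E) :=
  convexHull_min PointedCone.subset_hull (PointedCone.convex _)

/-- Applying `φ` to a nonnegative combination reads off the sum of its coefficients, so `φ x = -1`
makes it a convex combination. -/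
lemma mem_convexHull_iff_mem_hull (hφ : ∀ v ∈ s, φ v = -1) {x : E} :
    x ∈ convexHull ℝ (s : Set E) ↔ x ∈ PointedCone.hull ℝ (s : Set E) ∧ φ x = -1 := by
  refine ⟨fun hx => ⟨convexHull_subset_hull _ hx, map_eq_of_mem_convexHull hφ hx⟩, ?_⟩
  rintro ⟨hx, hx1⟩
  obtain ⟨c, hc, rfl⟩ := mem_hull_finset.1 hx
  have h1 : ∑ v ∈ s, c v = 1 := by
    rw [map_sum, Finset.sum_congr rfl fun v hv => by rw [map_smul, hφ v hv]] at hx1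
    simpa using hx1
  exact (convex_convexHull ℝ _).sum_mem (fun v _ => hc v) h1 fun v hv => subset_convexHull _ _ hv

lemma map_nonpos_of_mem_hull (hφ : ∀ v ∈ s, φ v = -1) {x : E}
    (hx : x ∈ PointedCone.hull ℝ (s : Set E)) : φ x ≤ 0 := by
  obtain ⟨c, hc, rfl⟩ := mem_hull_finset.1 hx
  rw [map_sum, Finset.sum_congr rfl fun v hv => by rw [map_smul, hφ v hv]]
  simpa using Finset.sum_nonneg fun v _ => hc v

lemma eq_zero_of_mem_hull_of_map_eq_zero (hφ : ∀ v ∈ s, φ v = -1) {x : E}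
    (hx : x ∈ PointedCone.hull ℝ (s : Set E)) (h0 : φ x = 0) : x = 0 := by
  obtain ⟨c, hc, rfl⟩ := mem_hull_finset.1 hx
  rw [map_sum, Finset.sum_congr rfl fun v hv => by rw [map_smul, hφ v hv]] at h0
  have h1 : ∑ v ∈ s, c v = 0 := by simpa using h0
  rw [Finset.sum_eq_zero_iff_of_nonneg fun v _ => hc v] at h1
  exact Finset.sum_eq_zero fun v hv => by rw [h1 v hv, zero_smul]

lemma sum_coord (hσ : IsBasisSet σ) (hφ : ∀ v ∈ σ, φ v = -1) (x : E) :
    ∑ v ∈ σ, coord σ v x = -φ x := by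
  have h : φ x = ∑ v ∈ σ, coord σ v x * -1 := by
    conv_lhs => rw [← sum_coord_smul hσ x]
    rw [map_sum]
    exact Finset.sum_congr rfl fun v hv => by rw [map_smul, hφ v hv, smul_eq_mul]
  simp [h]

lemma linearIndependent_of_affineIndependent (hφ : ∀ v ∈ s, φ v = -1)
    (h : AffineIndependent ℝ ((↑) : s → E)) : LinearIndependent ℝ ((↑) : s → E) := by
  rw [linearIndependent_iff']
  intro t c hc i hi
  rw [affineIndependent_iff] at h
  refine h t c ?_ hc i hi
  have := congrArg φ hc
  rw [map_sum, Finset.sum_congr rfl fun v _ => by rw [map_smul, hφ v v.2]] at this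
  simpa using this

end Slice

end BasisSet

/-! ### Regular triangulations: the simplices cover the cone -/

section RegularTriangulation

variable {E : Type*} [AddCommGroup E] [Module ℝ E]

/-- A point is generic with respect to `A` if it lies in no proper subspace spanned by elements
of `A`. -/
def IsGenericPoint (A : Finset E) (x : E) : Prop :=
  ∀ s ⊆ A, Submodule.span ℝ (s : Set E) ≠ ⊤ → x ∉ Submodule.span ℝ (s : Set E)

open Classical in
/-- The simplices of the triangulation of the cone over `A` induced by the heights `w`: the bases
contained in `A` whose interpolating linear form lies above `w`. -/
noncomputable def simplices (A : Finset E) (w : E → ℝ) : Finset (Finset E) :=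
  A.powerset.filter fun σ => IsBasisSet σ ∧ ∀ a ∈ A, w a ≤ interp σ w a

lemma mem_simplices {A : Finset E} {w : E → ℝ} {σ : Finset E} :
    σ ∈ simplices A w ↔ σ ⊆ A ∧ IsBasisSet σ ∧ ∀ a ∈ A, w a ≤ interp σ w a := by
  simp [simplices]

/-- Two bad values of `ε` would differ by a nonzero multiple of `z` lying in `p`, so there is at
most one. -/
lemma eventually_add_smul_notMem (p : Submodule ℝ E) {x z : E} (hz : z ∉ p) :
    ∀ᶠ ε : ℝ in 𝓝[>] 0, x + ε • z ∉ p := by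
  have hs : Set.Subsingleton {ε : ℝ | x + ε • z ∈ p} := by
    intro ε hε δ hδ
    by_contra hne
    have h1 : (ε - δ) • z ∈ p := by
      have := p.sub_mem hε hδ
      rwa [add_sub_add_left_eq_sub, ← sub_smul] at this
    exact hz ((p.smul_mem_iff (sub_ne_zero.2 hne)).1 h1)
  have h2 : ∀ᶠ ε : ℝ in 𝓝[≠] 0, x + ε • z ∉ p := by
    have := hs.finite.compl_mem_cofinite
    exact nhdsNE_le_cofinite 0 this
  exact h2.filter_mono (nhdsWithin_mono _ fun ε (hε : 0 < ε) => hε.ne')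

lemma eventually_pos_add_mul {a b : ℝ} (ha : 0 < a) : ∀ᶠ ε : ℝ in 𝓝[>] 0, 0 < a + ε * b := by
  have : Tendsto (fun ε : ℝ => a + ε * b) (𝓝 0) (𝓝 (a + 0 * b)) := by
    apply Continuous.tendsto (by fun_prop : Continuous fun ε : ℝ => a + ε * b)
  rw [zero_mul, add_zero] at this
  exact (this.eventually (lt_mem_nhds ha)).filter_mono nhdsWithin_le_nhds

lemma eventually_isGenericPoint (A : Finset E) {x z : E} (hz : IsGenericPoint A z) :
    ∀ᶠ ε : ℝ in 𝓝[>] 0, IsGenericPoint A (x + ε • z) := by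
  have : ∀ᶠ ε : ℝ in 𝓝[>] 0, ∀ s ∈ A.powerset, Submodule.span ℝ (s : Set E) ≠ ⊤ →
      x + ε • z ∉ Submodule.span ℝ (s : Set E) := by
    rw [Filter.eventually_all_finset]
    intro s hs
    by_cases h : Submodule.span ℝ (s : Set E) = ⊤
    · simp [h]
    · filter_upwards [eventually_add_smul_notMem (x := x) _ (hz s (Finset.mem_powerset.1 hs) h)]
        with ε hε _ using hε
  filter_upwards [this] with ε hε s hs using hε s (Finset.mem_powerset.2 hs)

lemma exists_isGenericPoint (A : Finset E) : ∃ z : E, IsGenericPoint A z := by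
  classical
  let S : Finset (Subspace ℝ E) :=
    (A.powerset.image fun s : Finset E => Submodule.span ℝ (s : Set E)).filter (· ≠ ⊤)
  have hS : ⊤ ∉ S := by simp [S]
  have h := Subspace.biUnion_ne_univ_of_top_notMem hS
  obtain ⟨z, hz⟩ := (Set.ne_univ_iff_exists_notMem _).1 h
  refine ⟨z, fun s hs hst hzs => hz ?_⟩
  simp only [Set.mem_iUnion]
  refine ⟨Submodule.span ℝ (s : Set E), ?_, hzs⟩
  simp only [S, Finset.mem_filter, Finset.mem_image, Finset.mem_powerset]
  exact ⟨⟨s, hs, rfl⟩, hst⟩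

lemma exists_isBasisSet_subset {A : Finset E} (hA : Submodule.span ℝ (A : Set E) = ⊤) :
    ∃ σ ⊆ A, IsBasisSet σ := by
  obtain ⟨b, hbA, hspan, hli⟩ := exists_linearIndependent ℝ (A : Set E)
  have hfin : b.Finite := A.finite_toSet.subset hbA
  refine ⟨hfin.toFinset, by simpa using hbA, ?_, ?_⟩
  · have : (hfin.toFinset : Set E) = b := hfin.coe_toFinset
    rw [← this] at hli
    exact hli
  · rw [hfin.coe_toFinset, hspan, hA]

/-- Move the sum of a basis contained in `A` slightly in a generic direction: its coordinates are
all 1 and stay positive. -/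
lemma exists_isGenericPoint_mem_hull {A : Finset E}
    (hA : Submodule.span ℝ (A : Set E) = ⊤) :
    ∃ y ∈ PointedCone.hull ℝ (A : Set E), IsGenericPoint A y := by
  obtain ⟨σ, hσA, hσ⟩ := exists_isBasisSet_subset hA
  obtain ⟨z, hz⟩ := exists_isGenericPoint A
  have h1 : ∀ᶠ ε : ℝ in 𝓝[>] 0, ∀ v ∈ σ, 0 < 1 + ε * coord σ v z := by
    rw [Filter.eventually_all_finset]
    exact fun v _ => eventually_pos_add_mul one_pos
  obtain ⟨ε, h2, h3⟩ := (h1.and (eventually_isGenericPoint A (x := ∑ v ∈ σ, v) hz)).exists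
  refine ⟨_, Submodule.span_mono (Finset.coe_subset.2 hσA) ?_, h3⟩
  rw [← PointedCone.hull, mem_hull_iff_coord_nonneg hσ]
  intro v hv
  have h4 : coord σ v (∑ v ∈ σ, v) = 1 := by
    simpa using coord_sum_smul hσ (fun _ => 1) hv
  rw [map_add, map_smul, h4]
  exact (h2 v hv).le

variable {φ : E →ₗ[ℝ] ℝ} {A : Finset E}

/-- Carathéodory in the slice `φ = -1` gives an independent set whose cone contains `x`; genericity
of `x` forces that set to span. -/
lemma exists_isBasisSet_of_isGenericPoint (hφ : ∀ v ∈ A, φ v = -1)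
    (hA : Submodule.span ℝ (A : Set E) = ⊤) {x : E} (hx : x ∈ PointedCone.hull ℝ (A : Set E))
    (hg : IsGenericPoint A x) :
    ∃ σ ⊆ A, IsBasisSet σ ∧ x ∈ PointedCone.hull ℝ (σ : Set E) := by
  by_cases h0 : φ x = 0
  · have := eq_zero_of_mem_hull_of_map_eq_zero hφ hx h0
    subst this
    obtain ⟨σ, hσA, hσ⟩ := exists_isBasisSet_subset hA
    exact ⟨σ, hσA, hσ, Submodule.zero_mem _⟩
  have hneg : 0 < -φ x := neg_pos.2 (lt_of_le_of_ne (map_nonpos_of_mem_hull hφ hx) h0)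
  set y := (-φ x)⁻¹ • x with hy
  have hxy : x = (-φ x) • y := by rw [hy, smul_inv_smul₀ hneg.ne']
  have hyc : y ∈ convexHull ℝ (A : Set E) := by
    rw [mem_convexHull_iff_mem_hull hφ]
    refine ⟨PointedCone.smul_mem _ (inv_pos.2 hneg).le hx, ?_⟩
    rw [hy, map_smul, smul_eq_mul]
    field_simp
  rw [convexHull_eq_union] at hyc
  simp only [Set.mem_iUnion] at hyc
  obtain ⟨t, htA, hti, hyt⟩ := hyc
  have hxt : x ∈ PointedCone.hull ℝ (t : Set E) := by
    rw [hxy]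
    exact PointedCone.smul_mem _ hneg.le (convexHull_subset_hull _ hyt)
  have htA' : t ⊆ A := Finset.coe_subset.1 htA
  refine ⟨t, htA', ⟨linearIndependent_of_affineIndependent
    (fun v hv => hφ v (htA' hv)) hti, ?_⟩, hxt⟩
  by_contra hne
  exact hg t htA' hne (PointedCone.hull_le_span ℝ _ hxt)

/-- A simplex-method pivot: `a` enters the basis and `v₀` leaves by the minimum ratio rule, which
keeps `x` in the cone. The value at `x` grows by `t * (w a - interp σ w a)`. -/
lemma exists_isBasisSet_exchange [FiniteDimensional ℝ E] {σ : Finset E} (hσ : IsBasisSet σ)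
    (hφ : ∀ v ∈ σ, φ v = -1) {a x : E} (haφ : φ a = -1) (haσ : a ∉ σ)
    (hx : ∀ v ∈ σ, 0 < coord σ v x) (w : E → ℝ) (hw : interp σ w a < w a) :
    ∃ v₀ ∈ σ, ∃ τ : Finset E, (∀ u, u ∈ τ ↔ u = a ∨ u ∈ σ ∧ u ≠ v₀) ∧ IsBasisSet τ ∧
      x ∈ PointedCone.hull ℝ (τ : Set E) ∧ interp σ w x < interp τ w x := by
  classical
  -- The coordinates of `a` sum to 1, so some ratio is available.
  have hpos : ∃ v ∈ σ, 0 < coord σ v a := by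
    by_contra! h
    have := sum_coord hσ hφ a
    rw [haφ] at this
    linarith [Finset.sum_nonpos h]
  obtain ⟨v₀, hv₀, hmin⟩ := Finset.exists_min_image (σ.filter fun v => 0 < coord σ v a)
    (fun v => coord σ v x / coord σ v a) (by
      obtain ⟨v, hv, h⟩ := hpos
      exact ⟨v, by simp [hv, h]⟩)
  rw [Finset.mem_filter] at hv₀
  obtain ⟨hv₀σ, hv₀a⟩ := hv₀
  set t := coord σ v₀ x / coord σ v₀ a with ht
  have htpos : 0 < t := div_pos (hx v₀ hv₀σ) hv₀a
  have hc0 : coord σ v₀ x - t * coord σ v₀ a = 0 := by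
    rw [ht]; field_simp; ring
  have hcn : ∀ v ∈ σ, 0 ≤ coord σ v x - t * coord σ v a := by
    intro v hv
    rcases le_or_gt (coord σ v a) 0 with h | h
    · nlinarith [hx v hv]
    · have := hmin v (by simp [hv, h])
      rw [le_div_iff₀ h] at this
      linarith
  set τ := insert a (σ.erase v₀) with hτ
  have hτb : IsBasisSet τ := by
    refine IsBasisSet.of_card ?_ ?_
    · rw [hτ, Finset.card_insert_of_notMem (by simp [haσ]), Finset.card_erase_add_one hv₀σ,
        hσ.card_eq]
    · have herase : ∀ v ∈ σ.erase v₀, v ∈ Submodule.span ℝ (τ : Set E) := fun v hv =>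
        Submodule.subset_span (by rw [hτ]; exact Finset.mem_coe.2 (Finset.mem_insert_of_mem hv))
      have ha : a ∈ Submodule.span ℝ (τ : Set E) :=
        Submodule.subset_span (by rw [hτ]; exact Finset.mem_coe.2 (Finset.mem_insert_self _ _))
      have h1 : coord σ v₀ a • v₀ = a - ∑ v ∈ σ.erase v₀, coord σ v a • v := by
        have h := Finset.add_sum_erase σ (fun v => coord σ v a • v) hv₀σ
        rw [sum_coord_smul hσ] at h
        exact eq_sub_of_add_eq h
      have h2 : v₀ ∈ Submodule.span ℝ (τ : Set E) := by
        rw [← Submodule.smul_mem_iff _ hv₀a.ne', h1]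
        exact Submodule.sub_mem _ ha
          (Submodule.sum_mem _ fun v hv => Submodule.smul_mem _ _ (herase v hv))
      rw [eq_top_iff, ← hσ.span_eq_top, Submodule.span_le]
      intro v hv
      by_cases h : v = v₀
      · rw [h]; exact h2
      · exact herase v (Finset.mem_erase.2 ⟨h, hv⟩)
  have hxe : x = t • a + ∑ v ∈ σ.erase v₀, (coord σ v x - t * coord σ v a) • v := by
    have h1 : ∑ v ∈ σ.erase v₀, (coord σ v x - t * coord σ v a) • v
        = ∑ v ∈ σ, (coord σ v x - t * coord σ v a) • v := by
      apply Finset.sum_erase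
      rw [hc0, zero_smul]
    rw [h1]
    simp only [sub_smul, Finset.sum_sub_distrib, mul_smul]
    rw [← Finset.smul_sum, sum_coord_smul hσ, sum_coord_smul hσ]
    abel
  have haτ : a ∈ τ := Finset.mem_insert_self _ _
  have hτe : ∀ v ∈ σ.erase v₀, v ∈ τ := fun v hv => Finset.mem_insert_of_mem hv
  refine ⟨v₀, hv₀σ, τ, ?_, hτb, ?_, ?_⟩
  · intro u
    simp [hτ, and_comm]
  · rw [hxe]
    refine Submodule.add_mem _
      (PointedCone.smul_mem _ htpos.le (PointedCone.subset_hull (Finset.mem_coe.2 haτ)))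
      (Submodule.sum_mem _ fun v hv => PointedCone.smul_mem _ (hcn v (Finset.mem_of_mem_erase hv))
        (PointedCone.subset_hull (Finset.mem_coe.2 (hτe v hv))))
  · have h1 : interp τ w x
        = t * w a + ∑ v ∈ σ, (coord σ v x - t * coord σ v a) * w v := by
      conv_lhs => rw [hxe]
      rw [map_add, map_smul, interp_self hτb w haτ, map_sum, smul_eq_mul]
      congr 1
      rw [← Finset.sum_erase (a := v₀) σ (by rw [hc0, zero_mul])]
      refine Finset.sum_congr rfl fun v hv => ?_
      rw [map_smul, interp_self hτb w (hτe v hv), smul_eq_mul]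
    have h2 : ∑ v ∈ σ, (coord σ v x - t * coord σ v a) * w v
        = interp σ w x - t * interp σ w a := by
      rw [interp_apply, interp_apply, Finset.mul_sum, ← Finset.sum_sub_distrib]
      exact Finset.sum_congr rfl fun v _ => by ring
    rw [h1, h2]
    nlinarith

/-- Among the finitely many bases whose cone contains `x`, take one with the largest interpolated
value at `x`. A point of `A` above its form would allow an improving pivot; genericity supplies the
positive coordinates that the pivot needs. -/
lemma exists_mem_simplices_of_isGenericPoint [FiniteDimensional ℝ E] (hφ : ∀ v ∈ A, φ v = -1)
    (hA : Submodule.span ℝ (A : Set E) = ⊤) (w : E → ℝ) {x : E}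
    (hx : x ∈ PointedCone.hull ℝ (A : Set E)) (hg : IsGenericPoint A x) :
    ∃ σ ∈ simplices A w, x ∈ PointedCone.hull ℝ (σ : Set E) := by
  classical
  obtain ⟨σ, hσC, hmax⟩ := Finset.exists_max_image
    (A.powerset.filter fun σ => IsBasisSet σ ∧ x ∈ PointedCone.hull ℝ (σ : Set E))
    (fun σ => interp σ w x) (by
      obtain ⟨σ, h1, h2⟩ := exists_isBasisSet_of_isGenericPoint hφ hA hx hg
      exact ⟨σ, by simp only [Finset.mem_filter, Finset.mem_powerset]; exact ⟨h1, h2⟩⟩)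
  simp only [Finset.mem_filter, Finset.mem_powerset] at hσC hmax
  obtain ⟨hσA, hσ, hxσ⟩ := hσC
  refine ⟨σ, mem_simplices.2 ⟨hσA, hσ, fun a ha => ?_⟩, hxσ⟩
  by_contra! hlt
  have haσ : a ∉ σ := fun h => hlt.ne (interp_self hσ w h)
  have hpos : ∀ v ∈ σ, 0 < coord σ v x := by
    intro v hv
    refine lt_of_le_of_ne (coord_nonneg_of_mem_hull hσ hxσ v) fun h0 => ?_
    refine hg (σ.erase v) ((Finset.erase_subset _ _).trans hσA)
      (hσ.span_ne_top hv (Finset.erase_subset _ _) (Finset.notMem_erase _ _)) ?_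
    have : x = ∑ u ∈ σ.erase v, coord σ u x • u := by
      conv_lhs => rw [← sum_coord_smul hσ x]
      rw [Finset.sum_erase]
      rw [← h0, zero_smul]
    rw [this]
    exact Submodule.sum_mem _ fun u hu =>
      Submodule.smul_mem _ _ (Submodule.subset_span (Finset.mem_coe.2 hu))
  obtain ⟨v₀, hv₀, τ, hτm, hτ, hxτ, hlt'⟩ := exists_isBasisSet_exchange hσ
    (fun v hv => hφ v (hσA hv)) (hφ a ha) haσ hpos w hlt
  have hτA : τ ⊆ A := by
    intro u hu
    rcases (hτm u).1 hu with rfl | ⟨h, -⟩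
    · exact ha
    · exact hσA h
  exact absurd (hmax τ ⟨hτA, hτ, hxτ⟩) (not_le.2 hlt')

/-- The simplices of a regular triangulation cover the cone. -/
lemma exists_mem_simplices [FiniteDimensional ℝ E] (hφ : ∀ v ∈ A, φ v = -1)
    (hA : Submodule.span ℝ (A : Set E) = ⊤) (w : E → ℝ) {x : E}
    (hx : x ∈ PointedCone.hull ℝ (A : Set E)) :
    ∃ σ ∈ simplices A w, x ∈ PointedCone.hull ℝ (σ : Set E) := by
  obtain ⟨y, hyA, hy⟩ := exists_isGenericPoint_mem_hull hA
  by_contra! hcon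
  -- A negative coordinate of `x` survives a small move towards `y`, so an uncovered `x` would have
  -- uncovered generic points nearby in the cone.
  have h1 : ∀ᶠ ε : ℝ in 𝓝[>] 0, ∀ σ ∈ simplices A w,
      x + ε • y ∉ PointedCone.hull ℝ (σ : Set E) := by
    rw [Filter.eventually_all_finset]
    intro σ hσT
    have hσ := (mem_simplices.1 hσT).2.1
    have h := hcon σ hσT
    rw [mem_hull_iff_coord_nonneg hσ] at h
    push Not at h
    obtain ⟨v, hv, hneg⟩ := h
    filter_upwards [eventually_pos_add_mul (b := -coord σ v y) (neg_pos.2 hneg)] with ε hε hmem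
    have := coord_nonneg_of_mem_hull hσ hmem v
    rw [map_add, map_smul, smul_eq_mul] at this
    linarith
  obtain ⟨ε, ⟨h2, h3⟩, h4⟩ :=
    ((h1.and (eventually_isGenericPoint A (x := x) hy)).and self_mem_nhdsWithin).exists
  obtain ⟨σ, hσ, hmem⟩ := exists_mem_simplices_of_isGenericPoint hφ hA w
    (Submodule.add_mem _ hx (PointedCone.smul_mem _ (le_of_lt h4) hyA)) h3
  exact h2 σ hσ hmem

end RegularTriangulation

/-! ### Intersections of simplices, faces of cones, and the simplicial complex -/

section Gluing

variable {E : Type*} [AddCommGroup E] [Module ℝ E]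

/-- The height function `w` is generic on `A`: above each simplex of the induced triangulation, the
interpolating form is strictly larger than `w` outside the simplex. -/
def IsGenericHeight (A : Finset E) (w : E → ℝ) : Prop :=
  ∀ σ ∈ simplices A w, ∀ a ∈ A, a ∉ σ → w a < interp σ w a

variable {A : Finset E} {w : E → ℝ} {σ τ s t : Finset E} {x : E}

/-- At the vertices of `τ` the form of `τ` equals `w`, and the form of `σ` is at least `w`. -/
lemma interp_le_interp (hσ : σ ∈ simplices A w) (hτ : τ ∈ simplices A w)
    (hx : x ∈ PointedCone.hull ℝ (τ : Set E)) : interp τ w x ≤ interp σ w x := by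
  obtain ⟨-, -, hσw⟩ := mem_simplices.1 hσ
  obtain ⟨hτA, hτb, -⟩ := mem_simplices.1 hτ
  obtain ⟨c, hc, rfl⟩ := mem_hull_finset.1 hx
  rw [map_sum, map_sum]
  refine Finset.sum_le_sum fun v hv => ?_
  rw [map_smul, map_smul, interp_self hτb w hv]
  exact mul_le_mul_of_nonneg_left (hσw v (hτA hv)) (hc v)

/-- The difference of the two forms at `x` is a sum over `τ` of coordinates times gaps, all
nonnegative, so every term vanishes. Genericity makes the gap positive at a vertex outside `σ`. -/
lemma coord_eq_zero_of_interp_le (hw : IsGenericHeight A w) (hσ : σ ∈ simplices A w)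
    (hτ : τ ∈ simplices A w) (hx : x ∈ PointedCone.hull ℝ (τ : Set E))
    (hle : interp σ w x ≤ interp τ w x) {v : E} (hv : v ∉ σ) : coord τ v x = 0 := by
  obtain ⟨-, -, hσw⟩ := mem_simplices.1 hσ
  obtain ⟨hτA, hτb, -⟩ := mem_simplices.1 hτ
  by_cases hvτ : v ∈ τ
  swap
  · simp [coord_of_notMem hvτ]
  have h1 : interp σ w x - interp τ w x = ∑ u ∈ τ, coord τ u x * (interp σ w u - w u) := by
    simp only [mul_sub, Finset.sum_sub_distrib]
    rw [← interp_apply τ w x]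
    congr 1
    conv_lhs => rw [← sum_coord_smul hτb x]
    rw [map_sum]
    exact Finset.sum_congr rfl fun u _ => by rw [map_smul, smul_eq_mul]
  have hnn : ∀ u ∈ τ, 0 ≤ coord τ u x * (interp σ w u - w u) := fun u hu =>
    mul_nonneg (coord_nonneg_of_mem_hull hτb hx u) (sub_nonneg.2 (hσw u (hτA hu)))
  have h2 : ∑ u ∈ τ, coord τ u x * (interp σ w u - w u) = 0 :=
    le_antisymm (by rw [← h1]; linarith) (Finset.sum_nonneg hnn)
  rw [Finset.sum_eq_zero_iff_of_nonneg hnn] at h2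
  rcases mul_eq_zero.1 (h2 v hvτ) with h | h
  · exact h
  · exact absurd h (sub_pos.2 (hw σ hσ v (hτA hvτ) hv)).ne'

lemma mem_hull_of_interp_le (hw : IsGenericHeight A w) (hσ : σ ∈ simplices A w)
    (hτ : τ ∈ simplices A w) (hx : x ∈ PointedCone.hull ℝ (τ : Set E))
    (hle : interp σ w x ≤ interp τ w x) : x ∈ PointedCone.hull ℝ (σ : Set E) := by
  obtain ⟨-, hτb, -⟩ := mem_simplices.1 hτ
  rw [← sum_coord_smul hτb x]
  refine Submodule.sum_mem _ fun v _ => ?_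
  by_cases hvσ : v ∈ σ
  · exact PointedCone.smul_mem _ (coord_nonneg_of_mem_hull hτb hx v)
      (PointedCone.subset_hull hvσ)
  · rw [coord_eq_zero_of_interp_le hw hσ hτ hx hle hvσ, zero_smul]
    exact Submodule.zero_mem _

/-- At a common point each form is at most the other, so the coordinates with respect to `τ` live on
`σ ∩ τ`. They therefore agree with those with respect to `σ`, and vanish outside both `s` and `t`.
-/
lemma hull_inf_hull [DecidableEq E] (hw : IsGenericHeight A w) (hσ : σ ∈ simplices A w)
    (hτ : τ ∈ simplices A w) (hs : s ⊆ σ) (ht : t ⊆ τ) :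
    PointedCone.hull ℝ (s : Set E) ⊓ PointedCone.hull ℝ (t : Set E) =
      PointedCone.hull ℝ ((s ∩ t : Finset E) : Set E) := by
  obtain ⟨-, hσb, -⟩ := mem_simplices.1 hσ
  obtain ⟨-, hτb, -⟩ := mem_simplices.1 hτ
  refine le_antisymm (fun x hx => ?_) (le_inf ?_ ?_)
  · obtain ⟨hxs, hxt⟩ := Submodule.mem_inf.1 hx
    have hxσ : x ∈ PointedCone.hull ℝ (σ : Set E) := Submodule.span_mono (by exact_mod_cast hs) hxs
    have hxτ : x ∈ PointedCone.hull ℝ (τ : Set E) := Submodule.span_mono (by exact_mod_cast ht) hxt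
    have h0 : ∀ v ∉ σ, coord τ v x = 0 := fun v hv =>
      coord_eq_zero_of_interp_le hw hσ hτ hxτ (interp_le_interp hτ hσ hxσ) hv
    have hsum : ∑ v ∈ σ, coord τ v x • v = x := by
      conv_rhs => rw [← sum_coord_smul hτb x]
      rw [← Finset.sum_subset (Finset.inter_subset_left (s₁ := σ) (s₂ := τ)),
        ← Finset.sum_subset (Finset.inter_subset_right (s₁ := σ) (s₂ := τ))]
      · intro v hv hvn
        rw [h0 v fun h => hvn (Finset.mem_inter.2 ⟨h, hv⟩), zero_smul]
      · intro v hv hvn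
        rw [coord_of_notMem fun h => hvn (Finset.mem_inter.2 ⟨hv, h⟩)]
        simp
    have heq : ∀ v ∈ σ, coord σ v x = coord τ v x := by
      intro v hv
      conv_lhs => rw [← hsum]
      exact coord_sum_smul hσb _ hv
    refine mem_hull_of_coord hσb (Finset.inter_subset_left.trans hs)
      (fun v _ => coord_nonneg_of_mem_hull hσb hxσ v) fun v hv hvn => ?_
    by_cases hvs : v ∈ s
    · rw [heq v hv]
      exact coord_eq_zero_of_mem_hull hτb ht hxt fun h => hvn (Finset.mem_inter.2 ⟨hvs, h⟩)
    · exact coord_eq_zero_of_mem_hull hσb hs hxs hvs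
  · exact Submodule.span_mono (by simp)
  · exact Submodule.span_mono (by simp)

lemma hull_isFaceOf_hull (hσ : IsBasisSet σ) (hs : s ⊆ σ) (hts : t ⊆ s) :
    (PointedCone.hull ℝ (t : Set E)).IsFaceOf (PointedCone.hull ℝ (s : Set E)) where
  le := Submodule.span_mono (by exact_mod_cast hts)
  mem_of_smul_add_mem := by
    intro x y a hx hy ha hmem
    have hsσ : PointedCone.hull ℝ (s : Set E) ≤ PointedCone.hull ℝ (σ : Set E) :=
      Submodule.span_mono (by exact_mod_cast hs)
    have hx0 := coord_nonneg_of_mem_hull hσ (hsσ hx)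
    have hy0 := coord_nonneg_of_mem_hull hσ (hsσ hy)
    refine mem_hull_of_coord hσ (hts.trans hs) (fun v _ => hx0 v) fun v _ hvt => ?_
    have h := coord_eq_zero_of_mem_hull hσ (hts.trans hs) hmem hvt
    rw [map_add, map_smul, smul_eq_mul] at h
    have h1 := hx0 v
    have h2 := hy0 v
    nlinarith [mul_nonneg ha.le h1]

/-- The face is generated by the generators it contains: whatever occurs with positive coefficient
in a point of a face lies in that face. -/
lemma exists_eq_hull_of_isFaceOf {s : Finset E} {F : PointedCone ℝ E}
    (hF : F.IsFaceOf (PointedCone.hull ℝ (s : Set E))) :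
    ∃ t ⊆ s, F = PointedCone.hull ℝ (t : Set E) := by
  classical
  refine ⟨s.filter (· ∈ F), Finset.filter_subset _ _, le_antisymm (fun x hx => ?_) ?_⟩
  · obtain ⟨c, hc, rfl⟩ := mem_hull_finset.1 (hF.le hx)
    refine Submodule.sum_mem _ fun v hv => ?_
    rcases (hc v).eq_or_lt with h | h
    · rw [← h, zero_smul]
      exact Submodule.zero_mem _
    · have hvF : v ∈ F := by
        rw [← Finset.sum_coe_sort s] at hx
        exact hF.mem_of_sum_smul_mem (f := fun i : s => (i : E)) (c := fun i => c i)
          (fun i => PointedCone.subset_hull i.2) (fun i => hc i) hx ⟨v, hv⟩ h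
      exact PointedCone.smul_mem _ h.le (PointedCone.subset_hull (by simp [hv, hvF]))
  · refine Submodule.span_le.2 fun v hv => ?_
    exact (Finset.mem_filter.1 (Finset.mem_coe.1 hv)).2

/-- The simplicial complex given by a generic height function on a finite subset of an affine
hyperplane that misses the origin. -/
def regularComplex {φ : E →ₗ[ℝ] ℝ} (hφ : ∀ v ∈ A, φ v = -1) (hw : IsGenericHeight A w) :
    Geometry.SimplicialComplex ℝ E :=
  Geometry.SimplicialComplex.ofErase {s | ∃ σ ∈ simplices A w, s ⊆ σ}
    (by
      rintro s ⟨σ, hσ, hs⟩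
      have h := (mem_simplices.1 hσ).2.1.linearIndependent.affineIndependent
      exact h.mono (by exact_mod_cast hs))
    (by
      rintro s t hts ⟨σ, hσ, hs⟩
      exact ⟨σ, hσ, le_trans hts hs⟩)
    (by
      classical
      rintro s ⟨σ, hσ, hs⟩ t ⟨τ, hτ, ht⟩ x ⟨hxs, hxt⟩
      have hsφ : ∀ v ∈ s, φ v = -1 := fun v hv => hφ v ((mem_simplices.1 hσ).1 (hs hv))
      have hstφ : ∀ v ∈ s ∩ t, φ v = -1 := fun v hv => hsφ v (Finset.mem_inter.1 hv).1
      rw [← Finset.coe_inter, mem_convexHull_iff_mem_hull hstφ, ← hull_inf_hull hw hσ hτ hs ht]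
      exact ⟨Submodule.mem_inf.2 ⟨convexHull_subset_hull _ hxs, convexHull_subset_hull _ hxt⟩,
        map_eq_of_mem_convexHull hsφ hxs⟩)

lemma mem_regularComplex_faces {φ : E →ₗ[ℝ] ℝ} (hφ : ∀ v ∈ A, φ v = -1)
    (hw : IsGenericHeight A w) :
    s ∈ (regularComplex hφ hw).faces ↔ (∃ σ ∈ simplices A w, s ⊆ σ) ∧ s ≠ ∅ :=
  Iff.rfl

lemma regularComplex_space [FiniteDimensional ℝ E] {φ : E →ₗ[ℝ] ℝ} (hφ : ∀ v ∈ A, φ v = -1)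
    (hA : Submodule.span ℝ (A : Set E) = ⊤) (hw : IsGenericHeight A w) :
    (regularComplex hφ hw).space = {x | x ∈ PointedCone.hull ℝ (A : Set E) ∧ φ x = -1} := by
  ext x
  rw [Geometry.SimplicialComplex.mem_space_iff]
  constructor
  · rintro ⟨s, hs, hx⟩
    obtain ⟨⟨σ, hσ, hsσ⟩, -⟩ := (mem_regularComplex_faces hφ hw).1 hs
    have hsA : s ⊆ A := hsσ.trans (mem_simplices.1 hσ).1
    exact (mem_convexHull_iff_mem_hull hφ).1 (convexHull_mono (by exact_mod_cast hsA) hx)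
  · rintro ⟨hx, hx1⟩
    obtain ⟨σ, hσ, hxσ⟩ := exists_mem_simplices hφ hA w hx
    refine ⟨σ, (mem_regularComplex_faces hφ hw).2 ⟨⟨σ, hσ, subset_rfl⟩, ?_⟩,
      (mem_convexHull_iff_mem_hull fun v hv => hφ v ((mem_simplices.1 hσ).1 hv)).2 ⟨hxσ, hx1⟩⟩
    rintro rfl
    have : x = 0 := by simpa [PointedCone.hull] using hxσ
    simp [this] at hx1

lemma exists_height_eq_min {T : Finset (Finset E)} (hT : T.Nonempty) (w : E → ℝ) :
    ∃ h : E → ℝ, ∀ x, (∀ σ ∈ T, h x ≤ interp σ w x) ∧ ∃ σ ∈ T, h x = interp σ w x := by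
  refine ⟨fun x => T.inf' hT fun σ => interp σ w x, fun x => ⟨fun σ hσ => ?_, ?_⟩⟩
  · exact Finset.inf'_le (fun σ => interp σ w x) hσ
  · exact Finset.exists_mem_eq_inf' hT fun σ => interp σ w x

end Gluing

/-! ### The fan over a regular triangulation and its support function -/

section RegularFan

variable {n : ℕ} {A : Finset (Fin n → ℝ)} {w : (Fin n → ℝ) → ℝ}
  {φ : (Fin n → ℝ) →ₗ[ℝ] ℝ}

lemma isStronglyConvex_hull {s : Finset (Fin n → ℝ)} (hφ : ∀ v ∈ s, φ v = -1) :
    IsStronglyConvex (PointedCone.hull ℝ (s : Set (Fin n → ℝ))) := by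
  intro x hx hnx
  have h1 := map_nonpos_of_mem_hull hφ hx
  have h2 := map_nonpos_of_mem_hull hφ hnx
  rw [map_neg] at h2
  exact eq_zero_of_mem_hull_of_map_eq_zero hφ hx (by linarith)

lemma mem_fanOver_regularComplex (hφ : ∀ v ∈ A, φ v = -1) (hw : IsGenericHeight A w)
    (hT : (simplices A w).Nonempty) {ρ : PointedCone ℝ (Fin n → ℝ)} :
    ρ ∈ fanOver (regularComplex hφ hw) ↔ ∃ σ ∈ simplices A w, ∃ s ⊆ σ,
      ρ = PointedCone.hull ℝ (s : Set (Fin n → ℝ)) := by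
  constructor
  · rintro (rfl | ⟨s, hs, rfl⟩)
    · obtain ⟨σ, hσ⟩ := hT
      exact ⟨σ, hσ, ∅, Finset.empty_subset _, by simp [PointedCone.hull]⟩
    · obtain ⟨⟨σ, hσ, hsσ⟩, -⟩ := (mem_regularComplex_faces hφ hw).1 hs
      exact ⟨σ, hσ, s, hsσ, rfl⟩
  · rintro ⟨σ, hσ, s, hs, rfl⟩
    by_cases h : s = ∅
    · left
      simp [h, PointedCone.hull]
    · exact Or.inr ⟨s, (mem_regularComplex_faces hφ hw).2 ⟨⟨σ, hσ, hs⟩, h⟩, rfl⟩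

lemma isFan_regularComplex (hlat : ∀ v ∈ A, IsLatticePoint v) (hφ : ∀ v ∈ A, φ v = -1)
    (hw : IsGenericHeight A w) (hT : (simplices A w).Nonempty) :
    IsFan (fanOver (regularComplex hφ hw)) where
  nonempty := ⟨⊥, Or.inl rfl⟩
  rational := by
    intro ρ hρ
    obtain ⟨σ, hσ, s, hs, rfl⟩ := (mem_fanOver_regularComplex hφ hw hT).1 hρ
    have hsA : s ⊆ A := hs.trans (mem_simplices.1 hσ).1
    exact ⟨⟨s, fun v hv => hlat v (hsA hv), rfl⟩,
      isStronglyConvex_hull fun v hv => hφ v (hsA hv)⟩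
  face_mem := by
    intro ρ hρ F hF
    obtain ⟨σ, hσ, s, hs, rfl⟩ := (mem_fanOver_regularComplex hφ hw hT).1 hρ
    obtain ⟨t, hts, rfl⟩ := exists_eq_hull_of_isFaceOf hF
    exact (mem_fanOver_regularComplex hφ hw hT).2 ⟨σ, hσ, t, hts.trans hs, rfl⟩
  inter_face := by
    intro ρ₁ h₁ ρ₂ h₂
    obtain ⟨σ, hσ, s, hs, rfl⟩ := (mem_fanOver_regularComplex hφ hw hT).1 h₁
    obtain ⟨τ, hτ, t, ht, rfl⟩ := (mem_fanOver_regularComplex hφ hw hT).1 h₂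
    rw [hull_inf_hull hw hσ hτ hs ht]
    exact ⟨hull_isFaceOf_hull (mem_simplices.1 hσ).2.1 hs Finset.inter_subset_left,
      hull_isFaceOf_hull (mem_simplices.1 hτ).2.1 ht Finset.inter_subset_right⟩

lemma support_fanOver_regularComplex (hφ : ∀ v ∈ A, φ v = -1)
    (hA : Submodule.span ℝ (A : Set (Fin n → ℝ)) = ⊤) (hw : IsGenericHeight A w)
    (hT : (simplices A w).Nonempty) :
    support (fanOver (regularComplex hφ hw)) =
      (PointedCone.hull ℝ (A : Set (Fin n → ℝ)) : Set (Fin n → ℝ)) := by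
  ext x
  constructor
  · rintro ⟨ρ, hρ, hx⟩
    obtain ⟨σ, hσ, s, hs, rfl⟩ := (mem_fanOver_regularComplex hφ hw hT).1 hρ
    have hsA : s ⊆ A := hs.trans (mem_simplices.1 hσ).1
    exact Submodule.span_mono (by exact_mod_cast hsA) hx
  · intro hx
    obtain ⟨σ, hσ, hxσ⟩ := exists_mem_simplices hφ hA w hx
    exact ⟨_, (mem_fanOver_regularComplex hφ hw hT).2 ⟨σ, hσ, σ, subset_rfl, rfl⟩, hxσ⟩

lemma coneDim_hull_le (s : Finset (Fin n → ℝ)) :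
    coneDim (PointedCone.hull ℝ (s : Set (Fin n → ℝ))) ≤ s.card := by
  have h : Submodule.span ℝ ((PointedCone.hull ℝ (s : Set (Fin n → ℝ)) : Set (Fin n → ℝ))) ≤
      Submodule.span ℝ (s : Set (Fin n → ℝ)) :=
    Submodule.span_le.2 (PointedCone.hull_le_span ℝ _)
  exact (Submodule.finrank_mono h).trans (finrank_span_finset_le_card s)

lemma eq_interp_of_mem_hull {h : (Fin n → ℝ) → ℝ}
    (hh : ∀ x, (∀ σ ∈ simplices A w, h x ≤ interp σ w x) ∧
      ∃ σ ∈ simplices A w, h x = interp σ w x) {σ : Finset (Fin n → ℝ)}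
    (hσ : σ ∈ simplices A w) {x : Fin n → ℝ}
    (hx : x ∈ PointedCone.hull ℝ (σ : Set (Fin n → ℝ))) : h x = interp σ w x := by
  refine le_antisymm ((hh x).1 σ hσ) ?_
  obtain ⟨τ, hτ, hxτ⟩ := (hh x).2
  rw [hxτ]
  exact interp_le_interp hτ hσ hx

/-- The minimum of the interpolating forms is a strictly upper convex support function. -/
lemma isStrictlyUpperConvex_regularComplex (hφ : ∀ v ∈ A, φ v = -1)
    (hA : Submodule.span ℝ (A : Set (Fin n → ℝ)) = ⊤) (hw : IsGenericHeight A w)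
    (hT : (simplices A w).Nonempty) {h : (Fin n → ℝ) → ℝ}
    (hh : ∀ x, (∀ σ ∈ simplices A w, h x ≤ interp σ w x) ∧
      ∃ σ ∈ simplices A w, h x = interp σ w x) :
    IsStrictlyUpperConvex (fanOver (regularComplex hφ hw)) h := by
  refine ⟨fun x _ y _ => ?_, fun ρ hρ hdim l hl x hx => ?_⟩
  -- A minimum of linear forms is superadditive: use the form attaining it at `x + y`.
  · obtain ⟨σ, hσ, hxy⟩ := (hh (x + y)).2
    rw [hxy, map_add]
    exact add_le_add ((hh x).1 σ hσ) ((hh y).1 σ hσ)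
  · obtain ⟨σ, hσ, s, hs, rfl⟩ := (mem_fanOver_regularComplex hφ hw hT).1 hρ
    have hσb := (mem_simplices.1 hσ).2.1
    -- A full-dimensional cone needs as many generators as the whole basis.
    have hsσ : s = σ := by
      refine Finset.eq_of_subset_of_card_le hs ?_
      have := coneDim_hull_le s
      rw [hdim] at this
      simpa [hσb.card_eq] using this
    subst hsσ
    have hll : l = interp s w := hσb.ext_dual fun v hv => by
      rw [← hl v (PointedCone.subset_hull hv),
        eq_interp_of_mem_hull hh hσ (PointedCone.subset_hull hv)]
    subst hll
    refine ⟨(hh x).1 s hσ, fun heq => ?_⟩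
    rw [support_fanOver_regularComplex hφ hA hw hT] at hx
    obtain ⟨τ, hτ, hxτ⟩ := exists_mem_simplices hφ hA w hx
    exact mem_hull_of_interp_le hw hσ hτ hxτ (heq ▸ (hh x).1 τ hτ)

lemma isSupportFunction_regularComplex (hφ : ∀ v ∈ A, φ v = -1) (hw : IsGenericHeight A w)
    (hT : (simplices A w).Nonempty) {h : (Fin n → ℝ) → ℝ}
    (hh : ∀ x, (∀ σ ∈ simplices A w, h x ≤ interp σ w x) ∧
      ∃ σ ∈ simplices A w, h x = interp σ w x) :
    IsSupportFunction (fanOver (regularComplex hφ hw)) h := by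
  intro ρ hρ
  obtain ⟨σ, hσ, s, hs, rfl⟩ := (mem_fanOver_regularComplex hφ hw hT).1 hρ
  exact ⟨interp σ w, fun x hx => eq_interp_of_mem_hull hh hσ
    (Submodule.span_mono (by exact_mod_cast hs) hx)⟩

end RegularFan

/-! ### Heights forced to vanish on `U` -/

section ZeroOn

variable {E : Type*} {U : Finset E}

open Classical in
/-- The function that agrees with `f` off `U` and vanishes on `U`. -/
noncomputable def zeroOn (U : Finset E) (f : E → ℝ) : E → ℝ := fun a => if a ∈ U then 0 else f a

lemma zeroOn_of_mem {f : E → ℝ} {a : E} (h : a ∈ U) : zeroOn U f a = 0 := if_pos h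

lemma zeroOn_of_notMem {f : E → ℝ} {a : E} (h : a ∉ U) : zeroOn U f a = f a := if_neg h

end ZeroOn

/-! ### Construction of generic heights -/

section Heights

variable {E : Type*} [AddCommGroup E] [Module ℝ E]

/-- The amount by which the height of `a` exceeds the form interpolating the heights on `σ`, as a
linear function of the heights. -/
noncomputable def heightGap (σ : Finset E) (a : E) : (E → ℝ) →ₗ[ℝ] ℝ :=
  LinearMap.proj (R := ℝ) (φ := fun _ : E => ℝ) a - ∑ v ∈ σ, coord σ v a • LinearMap.proj (R := ℝ) (φ := fun _ : E => ℝ) v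

lemma heightGap_apply (σ : Finset E) (a : E) (w : E → ℝ) :
    heightGap σ a w = w a - interp σ w a := by
  simp [heightGap, interp_apply]

variable {φ : E →ₗ[ℝ] ℝ} {A U : Finset E} {q : E → ℝ}

/-- For the height 1 off `U`, the gap at `a` is the total barycentric weight of `a` on `U`. If that
weight is zero, `a` is a convex combination of points off `U`, and strict Jensen for `q` decides at
the next order. -/
lemma heightGap_zeroOn_pos (hφ : ∀ v ∈ A, φ v = -1) (hq : StrictConvexOn ℝ Set.univ q)
    {σ : Finset E} (hσA : σ ⊆ A) (hσ : IsBasisSet σ) {a : E} (ha : a ∈ A) (haU : a ∉ U)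
    (haσ : a ∉ σ) (hmem : a ∈ PointedCone.hull ℝ (σ : Set E)) :
    0 < heightGap σ a (zeroOn U 1) ∨
      0 = heightGap σ a (zeroOn U 1) ∧ 0 < heightGap σ a (zeroOn U (-q)) := by
  have hc := coord_nonneg_of_mem_hull hσ hmem
  have hsum : ∑ v ∈ σ, coord σ v a = 1 := by
    rw [sum_coord hσ (fun v hv => hφ v (hσA hv)), hφ a ha, neg_neg]
  have h1 : heightGap σ a (zeroOn U 1) = ∑ v ∈ σ, coord σ v a * (1 - zeroOn U 1 v) := by
    rw [heightGap_apply, zeroOn_of_notMem haU, interp_apply]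
    simp only [mul_sub, mul_one, Finset.sum_sub_distrib, hsum, Pi.one_apply]
  have hnn : ∀ v ∈ σ, 0 ≤ coord σ v a * (1 - zeroOn U 1 v) := fun v _ => by
    refine mul_nonneg (hc v) ?_
    by_cases hv : v ∈ U
    · simp [zeroOn_of_mem hv]
    · simp [zeroOn_of_notMem hv]
  rw [h1]
  refine (Finset.sum_nonneg hnn).lt_or_eq.imp id fun h0 => ⟨h0, ?_⟩
  have hz : ∀ v ∈ σ, v ∈ U → coord σ v a = 0 := fun v hv hvU => by
    have := (Finset.sum_eq_zero_iff_of_nonneg hnn).1 h0.symm v hv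
    simpa [zeroOn_of_mem hvU] using this
  have h2 : heightGap σ a (zeroOn U (-q)) = ∑ v ∈ σ, coord σ v a • q v - q a := by
    rw [heightGap_apply, zeroOn_of_notMem haU, interp_apply, Pi.neg_apply, sub_eq_add_neg,
      add_comm, ← sub_eq_add_neg, ← Finset.sum_neg_distrib]
    congr 1
    refine Finset.sum_congr rfl fun v hv => ?_
    by_cases hvU : v ∈ U
    · simp [hz v hv hvU]
    · simp [zeroOn_of_notMem hvU]
  rw [h2, sub_pos]
  have hle := hq.convexOn.map_sum_le (fun v _ => hc v) hsum (fun v _ => Set.mem_univ (id v))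
  simp only [id, sum_coord_smul hσ] at hle
  refine lt_of_le_of_ne hle fun heq => ?_
  have hiff := hq.map_sum_eq_iff' (fun v _ => hc v) hsum (fun v _ => Set.mem_univ (id v))
  simp only [id, sum_coord_smul hσ] at hiff
  -- Equality in Jensen would identify `a` with each vertex of nonzero weight, but `a ∉ σ`.
  have hall : ∀ v ∈ σ, coord σ v a = 0 := fun v hv => by
    by_contra hne
    exact haσ (hiff.1 heq v hv hne ▸ hv)
  rw [Finset.sum_eq_zero hall] at hsum
  exact zero_ne_one hsum

/-- Finitely many linear forms, each nonzero on the space of heights vanishing on `U`, have a common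
point of nonvanishing. The test height is the indicator of `a` if `a ∉ U`, and otherwise that of the
vertex supplied by `hcol`. The excluded pairs are those whose gap sees only heights on `U`. -/
lemma exists_heightGap_ne_zero
    (hcol : ∀ σ ⊆ A, IsBasisSet σ → ¬ σ ⊆ U → ∀ u ∈ U, u ∉ σ → ∃ v ∈ σ, v ∉ U ∧ coord σ v u ≠ 0) :
    ∃ z : E → ℝ, (∀ u ∈ U, z u = 0) ∧ ∀ σ ∈ A.powerset, ∀ a ∈ A, IsBasisSet σ → a ∉ σ →
      ¬ (a ∈ U ∧ σ ⊆ U) → heightGap σ a z ≠ 0 := by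
  classical
  let S : Finset (Finset E × E) := (A.powerset ×ˢ A).filter fun p =>
    IsBasisSet p.1 ∧ p.2 ∉ p.1 ∧ ¬ (p.2 ∈ U ∧ p.1 ⊆ U)
  let W : Submodule ℝ (E → ℝ) := ⨅ u ∈ U, LinearMap.ker (LinearMap.proj u)
  have hW : ∀ z : E → ℝ, z ∈ W ↔ ∀ u ∈ U, z u = 0 := by
    intro z
    simp [W, Submodule.mem_iInf]
  have hWs : ∀ v ∉ U, Pi.single v (1 : ℝ) ∈ W := fun v hv => by
    rw [hW]
    intro u hu
    exact Pi.single_eq_of_ne (by rintro rfl; exact hv hu) _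
  obtain ⟨z, hz, hne⟩ := Module.Dual.exists_forall_mem_ne_zero_of_forall_exists W
    (fun p : S => heightGap p.1.1 p.1.2) (by
      rintro ⟨⟨σ, a⟩, hp⟩
      simp only [S, Finset.mem_filter, Finset.mem_product, Finset.mem_powerset] at hp
      obtain ⟨⟨hσA, -⟩, hσ, haσ, hnU⟩ := hp
      by_cases haU : a ∈ U
      · obtain ⟨v, hv, hvU, hc⟩ := hcol σ hσA hσ (fun h => hnU ⟨haU, h⟩) a haU haσ
        refine ⟨_, hWs v hvU, ?_⟩
        dsimp only
        rw [heightGap_apply, interp_apply,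
          Pi.single_eq_of_ne (by rintro rfl; exact hvU haU), Finset.sum_eq_single_of_mem v hv]
        · simpa using hc
        · intro u _ huv
          rw [Pi.single_eq_of_ne huv, mul_zero]
      · refine ⟨_, hWs a haU, ?_⟩
        dsimp only
        rw [heightGap_apply, interp_apply, Pi.single_eq_same, Finset.sum_eq_zero]
        · simp
        · intro u hu
          rw [Pi.single_eq_of_ne (by rintro rfl; exact haσ hu), mul_zero])
  refine ⟨z, (hW z).1 hz, fun σ hσA a ha hσ haσ hnU => hne ⟨(σ, a), ?_⟩⟩
  simp only [S, Finset.mem_filter, Finset.mem_product]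
  exact ⟨⟨hσA, ha⟩, hσ, haσ, hnU⟩

lemma eventually_heightGap_pos {σ : Finset E} {a : E} {w z : E → ℝ}
    (h : 0 < heightGap σ a w ∨ 0 = heightGap σ a w ∧ 0 < heightGap σ a z) :
    ∀ᶠ ε : ℝ in 𝓝[>] 0, 0 < heightGap σ a (w + ε • z) := by
  simp only [map_add, map_smul, smul_eq_mul]
  rcases h with h | ⟨h0, h⟩
  · exact eventually_pos_add_mul h
  · filter_upwards [self_mem_nhdsWithin] with ε hε
    rw [← h0, zero_add]
    exact mul_pos hε h

/-- There are generic heights vanishing on `U` for which every point of `A` lies strictly above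
each simplex that contains it in its interior or on its boundary. -/
lemma exists_isGenericHeight (hφ : ∀ v ∈ A, φ v = -1) (hq : StrictConvexOn ℝ Set.univ q)
    (hext : ∀ σ ⊆ A, ∀ u ∈ U, u ∉ σ → u ∉ PointedCone.hull ℝ (σ : Set E))
    (hcol : ∀ σ ⊆ A, IsBasisSet σ → ¬ σ ⊆ U → ∀ u ∈ U, u ∉ σ → ∃ v ∈ σ, v ∉ U ∧ coord σ v u ≠ 0)
    (hp : ∃ p ∈ A, p ∉ U) :
    ∃ w : E → ℝ, (∀ u ∈ U, w u = 0) ∧ IsGenericHeight A w ∧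
      ∀ σ ⊆ A, IsBasisSet σ → ∀ a ∈ A, a ∉ σ → a ∈ PointedCone.hull ℝ (σ : Set E) →
        interp σ w a < w a := by
  obtain ⟨p, hpA, hpU⟩ := hp
  have step1 : ∀ᶠ δ : ℝ in 𝓝[>] 0, ∀ σ ∈ A.powerset, ∀ a ∈ A, IsBasisSet σ → a ∉ σ →
      a ∈ PointedCone.hull ℝ (σ : Set E) →
        0 < heightGap σ a (zeroOn U 1 + δ • zeroOn U (-q)) := by
    simp only [Filter.eventually_all_finset, Filter.eventually_imp_distrib_left]
    intro σ hσA a ha hσ haσ hmem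
    rw [Finset.mem_powerset] at hσA
    exact eventually_heightGap_pos (heightGap_zeroOn_pos hφ hq hσA hσ ha
      (fun haU => hext σ hσA a haU haσ hmem) haσ hmem)
  have step1' : ∀ᶠ δ : ℝ in 𝓝[>] 0, 0 < (zeroOn U 1 + δ • zeroOn U (-q)) p := by
    simp only [Pi.add_apply, Pi.smul_apply, smul_eq_mul, zeroOn_of_notMem hpU, Pi.one_apply]
    exact eventually_pos_add_mul one_pos
  obtain ⟨δ, h1, h1p⟩ := (step1.and step1').exists
  set w₀ := zeroOn U 1 + δ • zeroOn U (-q) with hw₀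
  have hw₀U : ∀ u ∈ U, w₀ u = 0 := fun u hu => by
    simp [hw₀, zeroOn_of_mem hu]
  obtain ⟨z, hzU, hz⟩ := exists_heightGap_ne_zero hcol
  -- With `δ` fixed these are finitely many strict inequalities, which survive a small perturbation
  -- by `z`.
  have step2 : ∀ᶠ ε : ℝ in 𝓝[>] 0, ∀ σ ∈ A.powerset, ∀ a ∈ A, IsBasisSet σ → a ∉ σ →
      a ∈ PointedCone.hull ℝ (σ : Set E) → 0 < heightGap σ a (w₀ + ε • z) := by
    simp only [Filter.eventually_all_finset, Filter.eventually_imp_distrib_left]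
    intro σ hσA a ha hσ haσ hmem
    exact eventually_heightGap_pos (Or.inl (h1 σ hσA a ha hσ haσ hmem))
  have step2' : ∀ᶠ ε : ℝ in 𝓝[>] 0, 0 < (w₀ + ε • z) p := by
    simp only [Pi.add_apply, Pi.smul_apply, smul_eq_mul]
    exact eventually_pos_add_mul h1p
  have step3 : ∀ᶠ ε : ℝ in 𝓝[>] 0, ∀ σ ∈ A.powerset, ∀ a ∈ A, IsBasisSet σ → a ∉ σ →
      ¬ (a ∈ U ∧ σ ⊆ U) → heightGap σ a (w₀ + ε • z) ≠ 0 := by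
    simp only [Filter.eventually_all_finset, Filter.eventually_imp_distrib_left]
    intro σ hσA a ha hσ haσ hnU
    have := eventually_add_smul_notMem (⊥ : Submodule ℝ ℝ) (x := heightGap σ a w₀)
      (z := heightGap σ a z) (by simpa using hz σ hσA a ha hσ haσ hnU)
    simpa only [map_add, map_smul, Submodule.mem_bot] using this
  obtain ⟨ε, ⟨h2, h2p⟩, h3⟩ := ((step2.and step2').and step3).exists
  have hwU : ∀ u ∈ U, (w₀ + ε • z) u = 0 := fun u hu => by simp [hw₀U u hu, hzU u hu]
  refine ⟨w₀ + ε • z, hwU, fun σ hσT a ha haσ => ?_, fun σ hσA hσ a ha haσ hmem => ?_⟩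
  · obtain ⟨hσA, hσ, hle⟩ := mem_simplices.1 hσT
    refine lt_of_le_of_ne (hle a ha) fun heq => ?_
    refine h3 σ (Finset.mem_powerset.2 hσA) a ha hσ haσ (fun hU => ?_)
      (by rw [heightGap_apply, heq, sub_self])
    -- A simplex with all vertices in `U` has the zero form, which lies below the positive height of
    -- `p`.
    have h0 : interp σ (w₀ + ε • z) p = 0 := by
      rw [interp_apply]
      exact Finset.sum_eq_zero fun v hv => by rw [hwU v (hU.2 hv), mul_zero]
    exact absurd (hle p hpA) (by rw [h0]; exact not_le.2 h2p)
  · have := h2 σ (Finset.mem_powerset.2 hσA) a ha hσ haσ hmem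
    rw [heightGap_apply] at this
    linarith

end Heights

/-! ### Extreme points -/

section Vertices

variable {E : Type*} [AddCommGroup E] [Module ℝ E]

/-- Every point of the hull lies on a segment from `u` to the hull of the other points. If two
points other than `u` combined to `u`, solving for `u` would put it in that smaller hull. -/
lemma mem_extremePoints_convexHull {S : Set E} {u : E} (hu : u ∈ S)
    (h : u ∉ convexHull ℝ (S \ {u})) : u ∈ (convexHull ℝ S).extremePoints ℝ := by
  rcases (S \ {u}).eq_empty_or_nonempty with he | hne
  · have : S = {u} := Set.Subset.antisymm (Set.sdiff_eq_empty.1 he) (by simpa using hu)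
    rw [this]
    simp
  rw [(convex_convexHull ℝ S).mem_extremePoints_iff_convex_sdiff]
  refine ⟨subset_convexHull ℝ S hu, ?_⟩
  have hjoin : ∀ x ∈ convexHull ℝ S, ∃ y ∈ convexHull ℝ (S \ {u}), ∃ t : ℝ, 0 ≤ t ∧ t ≤ 1 ∧
      x = (1 - t) • u + t • y := by
    intro x hx
    rw [← Set.insert_sdiff_self_of_mem hu, convexHull_insert hne] at hx
    obtain ⟨u', hu', y, hy, a, b, ha, hb, hab, rfl⟩ := mem_convexJoin.1 hx
    rw [Set.mem_singleton_iff] at hu'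
    subst hu'
    exact ⟨y, hy, b, hb, by linarith, by rw [← hab]; congr 2; ring⟩
  rintro x ⟨hx, hxu⟩ y ⟨hy, hyu⟩ a b ha hb hab
  refine ⟨convex_convexHull ℝ S hx hy ha hb hab, fun heq => h ?_⟩
  obtain ⟨x', hx', s, hs0, -, rfl⟩ := hjoin x hx
  obtain ⟨y', hy', t, ht0, -, rfl⟩ := hjoin y hy
  rw [Set.mem_singleton_iff] at heq hxu hyu
  have hs : 0 < s := lt_of_le_of_ne hs0 (by rintro rfl; simp at hxu)
  have ht : 0 < t := lt_of_le_of_ne ht0 (by rintro rfl; simp at hyu)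
  have hpos : 0 < a * s + b * t := by
    rcases ha.eq_or_lt with rfl | ha
    · have : b = 1 := by linarith
      subst this; simpa using ht
    · nlinarith [mul_pos ha hs, mul_nonneg hb ht0]
  have hu' : (a * s + b * t) • u = (a * s) • x' + (b * t) • y' := by
    have h1 : u = (a + b) • u - (a * s + b * t) • u + ((a * s) • x' + (b * t) • y') := by
      conv_lhs => rw [← heq]
      module
    rw [hab, one_smul] at h1
    have h2 : u + ((a * s) • x' + (b * t) • y' - (a * s + b * t) • u) = u + 0 := by
      conv_rhs => rw [add_zero, h1]
      abel
    exact (sub_eq_zero.1 (add_left_cancel h2)).symm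
  have hu2 : u = (a * s / (a * s + b * t)) • x' + (b * t / (a * s + b * t)) • y' := by
    rw [← inv_smul_smul₀ hpos.ne' u, hu', smul_add, smul_smul, smul_smul, div_eq_inv_mul,
      div_eq_inv_mul]
  have hmem := convex_convexHull ℝ (S \ {u}) hx' hy'
    (a := a * s / (a * s + b * t)) (b := b * t / (a * s + b * t)) (by positivity) (by positivity)
    (by rw [← add_div, div_self hpos.ne'])
  rwa [← hu2] at hmem

lemma extremePoint_notMem_hull {φ : E →ₗ[ℝ] ℝ} {P : Set E} (hP : Convex ℝ P)
    (hφ : ∀ x ∈ P, φ x = -1) {u : E} (hu : u ∈ P.extremePoints ℝ) {s : Finset E}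
    (hs : (s : Set E) ⊆ P) (hus : u ∉ s) : u ∉ PointedCone.hull ℝ (s : Set E) := by
  intro hmem
  have h1 : u ∈ convexHull ℝ (s : Set E) :=
    (mem_convexHull_iff_mem_hull fun v hv => hφ v (hs hv)).2 ⟨hmem, hφ u hu.1⟩
  rw [hP.mem_extremePoints_iff_mem_sdiff_convexHull_sdiff] at hu
  have hsub : (s : Set E) ⊆ P \ {u} := by
    intro v hv
    refine ⟨hs hv, ?_⟩
    rintro rfl
    exact hus hv
  exact hu.2 (convexHull_mono hsub h1)

/-- The segment from `x` to `p` extends slightly beyond `p` inside `P`, so extremality of `p` forces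
`x = p`. -/
lemma eq_of_extremePoint_of_mem_intrinsicInterior [TopologicalSpace E] [IsTopologicalAddGroup E]
    [ContinuousSMul ℝ E] {P : Set E} {p x : E} (hp : p ∈ P.extremePoints ℝ)
    (hpi : p ∈ intrinsicInterior ℝ P) (hx : x ∈ P) : x = p := by
  obtain ⟨y, hy, rfl⟩ := mem_intrinsicInterior.1 hpi
  have hxs : x ∈ affineSpan ℝ P := subset_affineSpan ℝ P hx
  let f : ℝ → affineSpan ℝ P := fun t =>
    ⟨AffineMap.lineMap x (y : E) t, AffineMap.lineMap_mem t hxs y.2⟩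
  have hf : Continuous f := by
    refine Continuous.subtype_mk (?_ : Continuous fun t : ℝ => AffineMap.lineMap x (y : E) t) _
    simp only [AffineMap.lineMap_apply_module]
    fun_prop
  have hf1 : f 1 = y := by
    ext; simp [f]
  have h1 : ∀ᶠ t in 𝓝 (1 : ℝ), (f t : E) ∈ P := by
    have := hf.tendsto 1
    rw [hf1] at this
    exact this.eventually (mem_interior_iff_mem_nhds.1 hy)
  have h2 : ∀ᶠ t in 𝓝[>] (1 : ℝ), (f t : E) ∈ P := h1.filter_mono nhdsWithin_le_nhds
  obtain ⟨t, ht, ht1⟩ := (h2.and self_mem_nhdsWithin).exists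
  have ht1 : 1 < t := ht1
  refine (mem_extremePoints_iff_left.1 hp).2 x hx _ ht ?_
  have ht0 : 0 < t := by linarith
  refine ⟨1 - t⁻¹, t⁻¹, sub_pos.2 (inv_lt_one_of_one_lt₀ ht1), inv_pos.2 ht0, by ring, ?_⟩
  simp only [f, AffineMap.lineMap_apply_module, smul_add, smul_smul]
  rw [inv_mul_cancel₀ ht0.ne', one_smul, ← add_assoc, ← add_smul]
  have : 1 - t⁻¹ + t⁻¹ * (1 - t) = 0 := by field_simp; ring
  rw [this, zero_smul, zero_add]

/-- No extreme point is an affine combination of two others. -/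
lemma exists_coord_ne_zero_of_extremePoint {φ : E →ₗ[ℝ] ℝ} {P : Set E} (hP : Convex ℝ P)
    (hφ : ∀ x ∈ P, φ x = -1) {U σ : Finset E} (hU : ∀ u ∈ U, u ∈ P.extremePoints ℝ)
    (hσP : (σ : Set E) ⊆ P) (hσ : IsBasisSet σ) (hcard : σ.card ≤ 3) (hσU : ¬ σ ⊆ U) {u : E}
    (hu : u ∈ U) (huσ : u ∉ σ) : ∃ v ∈ σ, v ∉ U ∧ coord σ v u ≠ 0 := by
  classical
  by_contra! hcon
  obtain ⟨a, haσ, haU⟩ := Finset.not_subset.1 hσU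
  have hsumc : ∑ v ∈ σ, coord σ v u = 1 := by
    rw [sum_coord hσ (fun v hv => hφ v (hσP hv)), hφ u (hU u hu).1, neg_neg]
  by_cases hall : ∀ v ∈ σ, 0 ≤ coord σ v u
  · exact extremePoint_notMem_hull hP hφ (hU u hu) hσP huσ ((mem_hull_iff_coord_nonneg hσ).2 hall)
  push Not at hall
  obtain ⟨b, hbσ, hb⟩ := hall
  have hab : a ≠ b := by
    rintro rfl
    rw [hcon a haσ haU] at hb
    exact lt_irrefl _ hb
  obtain ⟨c, hcσ, hc⟩ : ∃ c ∈ σ, 0 < coord σ c u := by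
    by_contra! h
    linarith [Finset.sum_nonpos h]
  have hac : a ≠ c := by
    rintro rfl
    rw [hcon a haσ haU] at hc
    exact lt_irrefl _ hc
  have hbc : b ≠ c := by
    rintro rfl
    linarith
  -- The bound on the cardinality enters here: with `a` of coordinate zero, `u` is an affine
  -- combination of just `b` and `c`. As `b` has a negative coefficient, `c` lies between `u` and
  -- `b`, although `c ∈ U` is extreme.
  have hσe : σ = {a, b, c} := by
    refine (Finset.eq_of_subset_of_card_le ?_ ?_).symm
    · simp [Finset.insert_subset_iff, haσ, hbσ, hcσ]
    · rw [Finset.card_eq_three.2 ⟨a, b, c, hab, hac, hbc, rfl⟩]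
      exact hcard
  have hcU : c ∈ U := by
    by_contra h
    exact hc.ne' (hcon c hcσ h)
  have hue := sum_coord_smul hσ u
  have ha0 := hcon a haσ haU
  set β := coord σ b u
  set γ := coord σ c u
  have hue : β • b + γ • c = u := by
    rw [← hue]
    conv_rhs => rw [hσe]
    rw [Finset.sum_insert (by simp [hab, hac]), Finset.sum_pair hbc, ← hσe, ha0, zero_smul,
      zero_add]
  refine extremePoint_notMem_hull hP hφ (hU c hcU) (s := {u, b}) ?_ ?_ ?_
  · intro x hx
    simp only [Finset.coe_insert, Finset.coe_singleton, Set.mem_insert_iff,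
      Set.mem_singleton_iff] at hx
    rcases hx with rfl | rfl
    · exact (hU _ hu).1
    · exact hσP hbσ
  · simp only [Finset.mem_insert, Finset.mem_singleton, not_or]
    exact ⟨by rintro rfl; exact huσ hcσ, hbc.symm⟩
  · have : c = γ⁻¹ • u + (-β * γ⁻¹) • b := by
      rw [← hue, smul_add, smul_smul, smul_smul, inv_mul_cancel₀ hc.ne']
      module
    rw [this]
    refine Submodule.add_mem _ (PointedCone.smul_mem _ (inv_pos.2 hc).le
      (PointedCone.subset_hull (by simp))) (PointedCone.smul_mem _ ?_
      (PointedCone.subset_hull (by simp)))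
    exact mul_nonneg (neg_pos.2 hb).le (inv_pos.2 hc).le

end Vertices

/-! ### Lattice points and empty triangles -/

section Lattice

variable {n : ℕ}

lemma IsLatticePoint.add {x y : Fin n → ℝ} (hx : IsLatticePoint x) (hy : IsLatticePoint y) :
    IsLatticePoint (x + y) := by
  obtain ⟨a, ha⟩ := hx
  obtain ⟨b, hb⟩ := hy
  exact ⟨a + b, fun i => by simp [ha, hb]⟩

lemma IsLatticePoint.zsmul {x : Fin n → ℝ} (hx : IsLatticePoint x) (m : ℤ) :
    IsLatticePoint ((m : ℝ) • x) := by
  obtain ⟨a, ha⟩ := hx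
  exact ⟨m • a, fun i => by simp [ha]⟩

lemma IsLatticePoint.sub {x y : Fin n → ℝ} (hx : IsLatticePoint x) (hy : IsLatticePoint y) :
    IsLatticePoint (x - y) := by
  obtain ⟨a, ha⟩ := hx
  obtain ⟨b, hb⟩ := hy
  exact ⟨a - b, fun i => by simp [ha, hb]⟩

lemma IsLatticePoint.sum {ι : Type*} {s : Finset ι} {f : ι → Fin n → ℝ}
    (h : ∀ i ∈ s, IsLatticePoint (f i)) : IsLatticePoint (∑ i ∈ s, f i) :=
  Finset.sum_induction f IsLatticePoint (fun _ _ => IsLatticePoint.add)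
    ⟨0, fun i => by simp⟩ h

lemma finite_latticePoints {P : Set (Fin n → ℝ)} (hP : Bornology.IsBounded P) :
    {x | x ∈ P ∧ IsLatticePoint x}.Finite := by
  obtain ⟨r, hr⟩ := hP.subset_closedBall 0
  have hfin : (Set.Icc (fun _ : Fin n => ⌊-r⌋) (fun _ => ⌈r⌉)).Finite := Set.finite_Icc _ _
  refine (hfin.image fun (z : Fin n → ℤ) i => (z i : ℝ)).subset ?_
  rintro x ⟨hxP, z, hz⟩
  refine ⟨z, ?_, funext fun i => (hz i).symm⟩
  have hx : ‖x‖ ≤ r := by simpa using hr hxP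
  have hi : ∀ i, |(z i : ℝ)| ≤ r := fun i => by
    rw [← hz i, ← Real.norm_eq_abs]
    exact (norm_le_pi_norm x i).trans hx
  constructor
  · intro i
    exact Int.floor_le_iff.2 (by linarith [(abs_le.1 (hi i)).1])
  · intro i
    exact Int.le_ceil_iff.2 (by linarith [(abs_le.1 (hi i)).2])

/-- A lattice triangle in an affine plane missing the origin whose only lattice points are its
vertices is basic: every lattice point of the plane has integral barycentric coordinates. -/
lemma exists_int_coord {φ : (Fin n → ℝ) →ₗ[ℝ] ℝ} {σ : Finset (Fin n → ℝ)} (hσ : IsBasisSet σ)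
    (hφ : ∀ v ∈ σ, φ v = -1) (hcard : σ.card = 3) (hlat : ∀ v ∈ σ, IsLatticePoint v)
    (hempty : ∀ y, IsLatticePoint y → φ y = -1 → y ∈ PointedCone.hull ℝ (σ : Set (Fin n → ℝ)) →
      y ∈ σ) {x : Fin n → ℝ} (hx : IsLatticePoint x) (hxφ : φ x = -1) :
    ∃ c : (Fin n → ℝ) → ℤ, ∑ v ∈ σ, c v = 1 ∧ ∑ v ∈ σ, (c v : ℝ) • v = x := by
  classical
  have hsum : ∑ v ∈ σ, coord σ v x = 1 := by rw [sum_coord hσ hφ, hxφ, neg_neg]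
  have hvert : ∀ d : (Fin n → ℝ) → ℝ, (∀ v, 0 ≤ d v) → ∑ v ∈ σ, d v = 1 →
      IsLatticePoint (∑ v ∈ σ, d v • v) →
        ∃ y ∈ σ, ∀ v ∈ σ, d v = if v = y then 1 else 0 := by
    intro d hd hd1 hdl
    have hφd : φ (∑ v ∈ σ, d v • v) = -1 := by
      rw [map_sum, Finset.sum_congr rfl fun v hv => by rw [map_smul, hφ v hv]]
      simp [hd1]
    have hy := hempty _ hdl hφd (mem_hull_finset.2 ⟨d, hd, rfl⟩)
    refine ⟨_, hy, fun v hv => ?_⟩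
    rw [← coord_sum_smul hσ d hv]
    convert coord_self hσ hv hy
  have hfl : IsLatticePoint (∑ v ∈ σ, ((⌊coord σ v x⌋ : ℤ) : ℝ) • v) :=
    IsLatticePoint.sum fun v hv => (hlat v hv).zsmul _
  have hfract : ∑ v ∈ σ, Int.fract (coord σ v x) • v
      = x - ∑ v ∈ σ, ((⌊coord σ v x⌋ : ℤ) : ℝ) • v := by
    rw [eq_sub_iff_add_eq, ← Finset.sum_add_distrib, ← (sum_coord_smul hσ x :)]
    simp only [sum_coord_smul hσ x, ← add_smul, Int.fract_add_floor]
  have hfs : ∑ v ∈ σ, Int.fract (coord σ v x) = ((1 - ∑ v ∈ σ, ⌊coord σ v x⌋ : ℤ) : ℝ) := by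
    push_cast
    rw [← hsum, ← Finset.sum_sub_distrib]
    rfl
  -- The fractional parts of the barycentric coordinates sum to `m`, which is 0, 1 or 2. For 0 the
  -- coordinates are integral. For 1 the fractional parts, and for 2 their complements to 1, give a
  -- lattice point of the triangle; it must be a vertex, which forces a fractional part equal to 1.
  set m : ℤ := 1 - ∑ v ∈ σ, ⌊coord σ v x⌋ with hm
  have hnn : ∀ v ∈ σ, 0 ≤ Int.fract (coord σ v x) := fun v _ => Int.fract_nonneg _
  have hm0 : 0 ≤ m := by
    have := Finset.sum_nonneg hnn
    rw [hfs] at this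
    exact_mod_cast this
  have hne : σ.Nonempty := Finset.card_pos.1 (by omega)
  have hm3 : m < 3 := by
    have : ∑ v ∈ σ, Int.fract (coord σ v x) < ∑ _v ∈ σ, (1 : ℝ) :=
      Finset.sum_lt_sum_of_nonempty hne fun v _ => Int.fract_lt_one _
    rw [hfs, Finset.sum_const, hcard] at this
    have h3 : (m : ℝ) < 3 := by simpa using this
    exact_mod_cast h3
  have hfrl : IsLatticePoint (∑ v ∈ σ, Int.fract (coord σ v x) • v) := by
    rw [hfract]
    exact hx.sub hfl
  have hcases : m = 0 ∨ m = 1 ∨ m = 2 := by omega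
  rcases hcases with h | h | h
  · rw [h, Int.cast_zero, Finset.sum_eq_zero_iff_of_nonneg hnn] at hfs
    rw [Finset.sum_eq_zero fun v hv => by rw [hfs v hv, zero_smul]] at hfract
    refine ⟨fun v => ⌊coord σ v x⌋, by dsimp only; omega, (sub_eq_zero.1 hfract.symm).symm⟩
  · obtain ⟨y, hy, hall⟩ := hvert (fun v => Int.fract (coord σ v x)) (fun v => Int.fract_nonneg _)
      (by rw [hfs, h, Int.cast_one]) hfrl
    have := hall y hy
    rw [if_pos rfl] at this
    exact absurd this (Int.fract_lt_one _).ne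
  · obtain ⟨y, hy, hall⟩ := hvert (fun v => 1 - Int.fract (coord σ v x))
      (fun v => sub_nonneg.2 (Int.fract_lt_one _).le)
      (by rw [Finset.sum_sub_distrib, hfs, h, Finset.sum_const, hcard]; norm_num)
      (by
        simp only [sub_smul, one_smul, Finset.sum_sub_distrib]
        exact (IsLatticePoint.sum hlat).sub hfrl)
    obtain ⟨v, hv, hvy⟩ := Finset.exists_mem_ne (by omega : 1 < σ.card) y
    have := hall v hv
    rw [if_neg hvy] at this
    linarith [Int.fract_lt_one (coord σ v x)]

lemma strictConvexOn_sum_sq : StrictConvexOn ℝ Set.univ fun x : Fin n → ℝ => ∑ i, x i ^ 2 := by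
  refine ⟨convex_univ, fun x _ y _ hxy a b ha hb hab => ?_⟩
  obtain ⟨j, hj⟩ := Function.ne_iff.1 hxy
  have hsq : ∀ i, a * x i ^ 2 + b * y i ^ 2 - (a * x i + b * y i) ^ 2
      = a * b * (x i - y i) ^ 2 := fun i => by
    obtain rfl : b = 1 - a := by linarith
    ring
  have hab0 := mul_pos ha hb
  simp only [smul_eq_mul, Finset.mul_sum, ← Finset.sum_add_distrib, Pi.add_apply, Pi.smul_apply]
  refine Finset.sum_lt_sum (fun i _ => ?_) ⟨j, Finset.mem_univ _, ?_⟩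
  · nlinarith [hsq i, mul_nonneg hab0.le (sq_nonneg (x i - y i))]
  · nlinarith [hsq j, mul_pos hab0 (pow_pos (abs_pos.2 (sub_ne_zero.2 hj)) 2),
      sq_abs (x j - y j)]

end Lattice

/-! ### The polygon of a Gorenstein cone -/

section Gorenstein

variable {n : ℕ}

/-- The pairing with a fixed element of the dual lattice, as a linear form. -/
noncomputable def pairingForm (γ : Fin n → ℤ) : (Fin n → ℝ) →ₗ[ℝ] ℝ :=
  ∑ i, (γ i : ℝ) • LinearMap.proj (R := ℝ) (φ := fun _ : Fin n => ℝ) i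

lemma pairingForm_apply (γ : Fin n → ℤ) (x : Fin n → ℝ) : pairingForm γ x = pairing γ x := by
  simp [pairingForm, pairing]

variable {U : Finset (Fin n → ℝ)} {γ : Fin n → ℤ}

namespace IsGorensteinToricCone

lemma pairingForm_eq (hU : IsGorensteinToricCone U γ) : ∀ u ∈ U, pairingForm γ u = -1 :=
  fun u hu => by rw [pairingForm_apply, hU.gorenstein u hu]

lemma polytope_eq_convexHull (hU : IsGorensteinToricCone U γ) :
    polytope U γ = convexHull ℝ (U : Set (Fin n → ℝ)) := by
  ext x
  rw [mem_convexHull_iff_mem_hull hU.pairingForm_eq, pairingForm_apply]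
  rfl

lemma mem_extremePoints (hU : IsGorensteinToricCone U γ) :
    ∀ u ∈ U, u ∈ (polytope U γ).extremePoints ℝ := by
  intro u hu
  rw [hU.polytope_eq_convexHull]
  refine mem_extremePoints_convexHull hu fun hmem => hU.minimal u hu ?_
  refine le_antisymm (Submodule.span_mono Set.sdiff_subset) (Submodule.span_le.2 fun v hv => ?_)
  by_cases h : v = u
  · rw [h]
    exact convexHull_subset_hull _ hmem
  · exact Submodule.subset_span ⟨hv, h⟩

lemma span_eq_top (hU : IsGorensteinToricCone U γ) :
    Submodule.span ℝ (U : Set (Fin n → ℝ)) = ⊤ := by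
  have h1 : Submodule.span ℝ ((PointedCone.hull ℝ (U : Set (Fin n → ℝ)) : Set (Fin n → ℝ))) = ⊤ :=
    Submodule.eq_top_of_finrank_eq (by simpa [coneDim] using hU.fullDim)
  rw [eq_top_iff, ← h1, Submodule.span_le]
  exact PointedCone.hull_le_span ℝ _

lemma notMem_of_mem_intrinsicInterior (hU : IsGorensteinToricCone U γ) (hn : 2 ≤ n)
    {p : Fin n → ℝ} (hp : p ∈ intrinsicInterior ℝ (polytope U γ)) : p ∉ U := by
  intro hpU
  have hcard : 1 < U.card := by
    have := coneDim_hull_le U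
    rw [hU.fullDim] at this
    omega
  obtain ⟨x, hx, hxp⟩ := Finset.exists_mem_ne hcard p
  refine hxp (eq_of_extremePoint_of_mem_intrinsicInterior (hU.mem_extremePoints p hpU) hp ?_)
  rw [hU.polytope_eq_convexHull]
  exact subset_convexHull ℝ _ hx

/-- The polytope has finitely many lattice points. -/
lemma exists_latticePoints (hU : IsGorensteinToricCone U γ) :
    ∃ A : Finset (Fin n → ℝ), ∀ x, x ∈ A ↔ x ∈ polytope U γ ∧ IsLatticePoint x := by
  have hb : Bornology.IsBounded (polytope U γ) := by
    rw [hU.polytope_eq_convexHull]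
    exact (U.finite_toSet.isCompact_convexHull ℝ).isBounded
  exact ⟨(finite_latticePoints hb).toFinset, fun x => by simp⟩

end IsGorensteinToricCone

lemma isSubdivision_regularComplex {A : Finset (Fin n → ℝ)} {w : (Fin n → ℝ) → ℝ}
    {φ : (Fin n → ℝ) →ₗ[ℝ] ℝ} (hlat : ∀ v ∈ A, IsLatticePoint v) (hφ : ∀ v ∈ A, φ v = -1)
    (hA : Submodule.span ℝ (A : Set (Fin n → ℝ)) = ⊤) (hw : IsGenericHeight A w)
    (hT : (simplices A w).Nonempty)
    (hAU : PointedCone.hull ℝ (A : Set (Fin n → ℝ)) = PointedCone.hull ℝ (U : Set (Fin n → ℝ))) :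
    IsSubdivision (fanOver (regularComplex hφ hw)) (coneFan U) := by
  have hsupp := support_fanOver_regularComplex hφ hA hw hT
  refine ⟨isFan_regularComplex hlat hφ hw hT, fun ρ hρ => ?_, ?_⟩
  · refine ⟨_, PointedCone.IsFaceOf.refl (PointedCone.hull ℝ (U : Set (Fin n → ℝ))), fun x hx => ?_⟩
    have : x ∈ support (fanOver (regularComplex hφ hw)) := ⟨ρ, hρ, hx⟩
    rwa [hsupp, hAU] at this
  · rw [hsupp, hAU]
    ext x
    constructor
    · intro hx
      exact ⟨_, PointedCone.IsFaceOf.refl _, hx⟩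
    · rintro ⟨ρ, hρ, hx⟩
      exact hρ.le hx

end Gorenstein

end ToricCone

/-! ### Assembly of the triangulation and the support function -/

open ToricCone in
theorem proposition3p10 (U : Finset (Fin 3 → ℝ)) (γ : Fin 3 → ℤ)
    (hU : ToricCone.IsGorensteinToricCone U γ)
    (hint : ∃ p ∈ intrinsicInterior ℝ (ToricCone.polytope U γ), ToricCone.IsLatticePoint p) :
    ∃ K : Geometry.SimplicialComplex ℝ (Fin 3 → ℝ),
      ToricCone.IsBasicLatticeTriangulation K U γ ∧
      ToricCone.IsSubdivision (ToricCone.fanOver K) (ToricCone.coneFan U) ∧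
      ∃ h : (Fin 3 → ℝ) → ℝ,
        ToricCone.IsCompactStrictlyUpperConvexSupportFunction U (ToricCone.fanOver K) h := by
  obtain ⟨p, hpi, hpl⟩ := hint
  obtain ⟨A, hA⟩ := hU.exists_latticePoints
  have hlat : ∀ v ∈ A, IsLatticePoint v := fun v hv => ((hA v).1 hv).2
  have hAP : ∀ v ∈ A, v ∈ polytope U γ := fun v hv => ((hA v).1 hv).1
  have hPφ : ∀ x ∈ polytope U γ, pairingForm γ x = -1 := fun x hx => by
    rw [pairingForm_apply, hx.2]
  have hφ : ∀ v ∈ A, pairingForm γ v = -1 := fun v hv => hPφ v (hAP v hv)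
  have hP : Convex ℝ (polytope U γ) := by
    rw [hU.polytope_eq_convexHull]
    exact convex_convexHull ℝ _
  have hUA : U ⊆ A := fun u hu => (hA u).2 ⟨(hU.mem_extremePoints u hu).1, (hU.primitive u hu).1⟩
  have hspan : Submodule.span ℝ (A : Set (Fin 3 → ℝ)) = ⊤ :=
    top_le_iff.1 (hU.span_eq_top ▸ Submodule.span_mono (by exact_mod_cast hUA))
  have hcard : ∀ σ : Finset (Fin 3 → ℝ), IsBasisSet σ → σ.card = 3 := fun σ hσ => by
    simpa using hσ.card_eq
  have hext : ∀ σ ⊆ A, ∀ u ∈ U, u ∉ σ → u ∉ PointedCone.hull ℝ (σ : Set (Fin 3 → ℝ)) :=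
    fun σ hσA u hu huσ => extremePoint_notMem_hull hP hPφ (hU.mem_extremePoints u hu)
      (fun v hv => hAP v (hσA hv)) huσ
  obtain ⟨w, hwU, hw, hwA⟩ := exists_isGenericHeight hφ strictConvexOn_sum_sq hext
    (fun σ hσA hσ hσU u hu huσ => exists_coord_ne_zero_of_extremePoint hP hPφ
      hU.mem_extremePoints (fun v hv => hAP v (hσA hv)) hσ (hcard σ hσ).le hσU hu huσ)
    -- The interior point serves only as a lattice point of the polygon outside `U`.
    ⟨p, (hA p).2 ⟨intrinsicInterior_subset hpi, hpl⟩,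
      hU.notMem_of_mem_intrinsicInterior (by norm_num) hpi⟩
  have hT : (simplices A w).Nonempty := by
    obtain ⟨σ, hσ, -⟩ := exists_mem_simplices hφ hspan w (x := 0) (Submodule.zero_mem _)
    exact ⟨σ, hσ⟩
  have hAU : PointedCone.hull ℝ (A : Set (Fin 3 → ℝ)) =
      PointedCone.hull ℝ (U : Set (Fin 3 → ℝ)) :=
    le_antisymm (Submodule.span_le.2 fun v hv => (hAP v hv).1)
      (Submodule.span_mono (by exact_mod_cast hUA))
  obtain ⟨h, hh⟩ := exists_height_eq_min hT w
  refine ⟨regularComplex hφ hw, ⟨?_, ?_, ?_⟩,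
    isSubdivision_regularComplex hlat hφ hspan hw hT hAU, h,
    isSupportFunction_regularComplex hφ hw hT hh,
    isStrictlyUpperConvex_regularComplex hφ hspan hw hT hh, fun u hu => ?_⟩
  · rw [regularComplex_space hφ hspan hw, hAU]
    simp only [pairingForm_apply]
    rfl
  · intro s hs v hv
    obtain ⟨⟨σ, hσ, hsσ⟩, -⟩ := (mem_regularComplex_faces hφ hw).1 hs
    exact hlat v ((mem_simplices.1 hσ).1 (hsσ hv))
  · intro s hs hs3 x hx hxγ
    obtain ⟨⟨σ, hσT, hsσ⟩, -⟩ := (mem_regularComplex_faces hφ hw).1 hs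
    obtain ⟨hσA, hσ, hle⟩ := mem_simplices.1 hσT
    obtain rfl : s = σ := Finset.eq_of_subset_of_card_le hsσ (by rw [hcard σ hσ, hs3])
    refine exists_int_coord hσ (fun v hv => hφ v (hσA hv)) hs3 (fun v hv => hlat v (hσA hv))
      (fun y hy hyφ hys => ?_) hx (by rw [pairingForm_apply, hxγ])
    by_contra hyn
    have hyA : y ∈ A := by
      refine (hA y).2 ⟨⟨?_, by rw [← pairingForm_apply, hyφ]⟩, hy⟩
      rw [← hAU]
      exact Submodule.span_mono (by exact_mod_cast hσA) hys
    -- A further lattice point in the triangle would be strictly above its form, contradicting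
    -- membership in `simplices`.
    exact absurd (hle y hyA) (not_le.2 (hwA s hσA hσ y hyA hyn hys))
  · obtain ⟨σ, hσT, huσ⟩ := exists_mem_simplices hφ hspan w
      (PointedCone.subset_hull (Finset.mem_coe.2 (hUA hu)))
    obtain ⟨hσA, hσ, -⟩ := mem_simplices.1 hσT
    -- Extremality makes `u` a vertex of any simplex whose cone contains it.
    have huσ' : u ∈ σ := by
      by_contra hn
      exact hext σ hσA u hu hn huσ
    rw [eq_interp_of_mem_hull hh hσT huσ, interp_self hσ w huσ', hwU u hu]
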